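/- **Model.** There are finitely many advertisers $i\in N$ and a finite universe $S$ of rich ads, total space $W>0$, and public spaces $0<w_{ij}\le W$ and click probabilities $\alpha_{ij}\in[0,1]$ ($i\in N$, $j\in S$). Advertiser $i$ has a private type $(v_i,A_i)$: a value per click $v_i\ge 0$ and a set $A_i\subseteq S$ of ads; put $v_{ij}=\alpha_{ij}v_i$ if $j\in A_i$ and $v_{ij}=0$ otherwise. She reports a bid $b_i\ge 0$ and a set $S_i\subseteq A_i$; put $b_{ij}=\alpha_{ij}b_i$ if $j\in S_i$ and $b_{ij}=0$ otherwise. For an allocation rule $x$ with allocation probabilities $x_{ij}$, the expected number of clicks of $i$ is $x_i=\sum_{j\in S_i}x_{ij}\alpha_{ij}$, and the social welfare is $\sum_{i,j}x_{ij}v_{ij}$. $OPT(\mathbf v,\mathbf A)$ is the maximal social welfare of an integral allocation that gives each advertiser at most one ad and uses total space at most $W$. **Mechanism.** $ALG_B$ allots space $W_i$ to the advertisers, starting from $W_i=0$, remaining space $w=W$, and all reported ads available. As long as $w\ne 0$ and an ad is available, it takes the available ad $(i,j)$ with highest bang-per-buck $b_{ij}/w_{ij}$ and makes all ads of $i$ of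 space at most $w_{ij}$ unavailable; if $w\ge w_{ij}-W_i$ it decreases $w$ by $w_{ij}-W_i$ and sets $W_i=w_{ij}$, and otherwise it increases $W_i$ by $w$ and sets $w=0$. $ALG_I$ runs $ALG_B$ and gives every advertiser $i$ one ad $j\in S_i$ with $w_{ij}\le W_i$ maximizing $b_{ij}$ (nothing if there is none). $ALG_{\max}$ allocates only one ad $(i,j)$, $j\in S_i$, with the largest $b_{ij}$. Ties are broken by fixed, arbitrary priority orders on the pairs $(i,j)$. For an allocation rule $x$, the GSP price per click of $i$ is $cpc_i=\inf\{b_i'\ge 0: x_i(b_i',S_i,\mathbf b_{-i},\mathbf S_{-i})=x_i(\mathbf b,\mathbf S)\}$ and the GSP payment is $p_i=x_i(\mathbf b,\mathbf S)\,cpc_i$. The mechanism $\mathcal M$ runs $ALG_I$ with probability $1/2$ and $ALG_{\max}$ with probability $1/2$, charging in each case the GSP payment of the rule that is run. Utilities are $u_i=v_ix_i-p_i$, in expectation over the coin flip. **Equilibria.** Let $(\mathbf v,\mathbf A)$ be drawn from an arbitrary, possibly correlated, probability distribution $\mathcal D$. A Bayes-Nash equilibrium is a profile of (possibly randomized, independently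 across advertisers given the types) maps from types $(v_i,A_i)$ to reports $(b_i,S_i)$ with $S_i\subseteq A_i$, such that for each $i$ and almost every type $(v_i,A_i)$ of $i$, no report $(b_i',S_i')$ with $b_i'\ge 0$, $S_i'\subseteq A_i$ gives $i$ a larger expected utility, the expectation being over the types of the others conditioned on $(v_i,A_i)$ and over all randomized reports. It satisfies no overbidding if $b_i\le v_i$ almost surely for all $i$. The Bayes-Nash price of anarchy under no overbidding is $$\sup \frac{\mathbb E_{(\mathbf v,\mathbf A)}\,[OPT(\mathbf v,\mathbf A)]}{\mathbb E_{(\mathbf v,\mathbf A),(\mathbf b,\mathbf S)}\,[SW(\mathcal M(\mathbf b,\mathbf S))]},$$ the supremum being over all $\mathcal D$ and all Bayes-Nash equilibria without overbidding (a ratio $c/0$ with $c>0$ counts as $\infty$; the undefined ratios $0/0$ and $\infty/\infty$ are disregarded). **Theorem.** For every such auction, the Bayes-Nash price of anarchy of $\mathcal M$ under no overbidding is at most $\dfrac{6}{1-1/e}$. -/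

import Mathlib

open MeasureTheory ProbabilityTheory
open scoped NNReal ENNReal

namespace RichAds

/-- A (true or reported) type of an advertiser: a value (or bid) per click and a set of rich ads. -/
abbrev AdType (S : Type*) := ℝ≥0 × Finset S

/-- A profile of (true or reported) types, one for every advertiser. -/
abbrev Profile (N S : Type*) := N → AdType S

/-- The public data of a rich ad auction with advertisers `N` and universe of rich ads `S`:
the total space `W`, the space `w i j` and the click probability `α i j` of every rich ad.
The three injections to `ℕ` are priorities (higher wins) by which the algorithms break ties. -/
structure Auction (N S : Type*) where
  W : ℝ
  w : N → S → ℝ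
  α : N → S → ℝ
  W_pos : 0 < W
  w_pos : ∀ i j, 0 < w i j
  w_le : ∀ i j, w i j ≤ W
  α_nonneg : ∀ i j, 0 ≤ α i j
  α_le_one : ∀ i j, α i j ≤ 1
  /-- tie-breaking in the bang-per-buck order -/
  tieB : N × S ↪ ℕ
  /-- tie-breaking in the post-processing step -/
  tieI : N × S ↪ ℕ
  /-- tie-breaking in the choice of the maximum value ad -/
  tieM : N × S ↪ ℕ

/-- The element of `A` at which `f` is largest, ties being broken in favour of the highest
priority; `none` if `A` is empty. -/
noncomputable def pick {E : Type*} (prio : E ↪ ℕ) (f : E → ℝ) (A : Finset E) : Option E :=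
  if h : A.Nonempty then
    some (A.exists_max_image (fun e => toLex (f e, prio e)) h).choose
  else none

/-- An allocation rule: `x r i j` is the probability that ad `j` is allocated to advertiser `i`
when the reports are `r`. -/
abbrev AllocRule (N S : Type*) := Profile N S → N → S → ℝ

/-- A mechanism: an allocation rule and the expected payment of every advertiser. -/
structure Mechanism (N S : Type*) where
  alloc : AllocRule N S
  pay : Profile N S → N → ℝ

/-- The allocation rule of a deterministic integral rule, which gives every advertiser at most
one rich ad. -/
def ofIntegral {N S : Type*} [DecidableEq S] (g : Profile N S → N → Option S) : AllocRule N S :=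
  fun r i j => if g r i = some j then 1 else 0

/-- Run `M₁` with probability `p` and `M₂` with probability `1 - p`, in expectation over the
coin flip; the payment is the one of the mechanism that is run. -/
def mix {N S : Type*} (p : ℝ) (M₁ M₂ : Mechanism N S) : Mechanism N S where
  alloc r i j := p * M₁.alloc r i j + (1 - p) * M₂.alloc r i j
  pay r i := p * M₁.pay r i + (1 - p) * M₂.pay r i

/-- The state of the bang-per-buck algorithm: the remaining space, the ads that are still
available, and the space allotted to every advertiser so far. -/
structure BState (N S : Type*) where
  free : ℝ
  avail : Finset (N × S)
  space : N → ℝ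

namespace Auction

variable {N S : Type*} [Fintype N] [Fintype S] [DecidableEq N] [DecidableEq S] (E : Auction N S)

/-- The reported value `b_{ij}` (or, for a profile of true types, the value `v_{ij}`) of ad `j`
for advertiser `i`: bid times click probability for the ads in the set, `0` for the others. -/
def adValue (r : Profile N S) (e : N × S) : ℝ :=
  if e.2 ∈ (r e.1).2 then ((r e.1).1 : ℝ) * E.α e.1 e.2 else 0

/-- The reported ads. -/
def ads (r : Profile N S) : Finset (N × S) := Finset.univ.filter fun e => e.2 ∈ (r e.1).2

/-- Bang-per-buck of an ad. -/
noncomputable def bangPerBuck (r : Profile N S) (e : N × S) : ℝ :=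
  E.adValue r e / E.w e.1 e.2

/-- One round of the bang-per-buck algorithm `ALG_B`. While space remains, take the available ad
`(i, j)` of highest bang-per-buck, make unavailable all ads of `i` of space at most `w i j`, and
enlarge the space of `i` to `w i j`, or by whatever remains if this does not fit. (As long as
space remains, the space of `i` is the space of the ad previously allocated to `i`.) -/
noncomputable def stepB (r : Profile N S) (s : BState N S) : BState N S :=
  if s.free = 0 then s
  else
    match pick E.tieB (E.bangPerBuck r) s.avail with
    | none => s
    | some (i, j) =>
      if E.w i j - s.space i ≤ s.free then
        { free := s.free - (E.w i j - s.space i)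
          avail := s.avail.filter fun e => ¬ (e.1 = i ∧ E.w e.1 e.2 ≤ E.w i j)
          space := Function.update s.space i (E.w i j) }
      else
        { free := 0
          avail := s.avail.filter fun e => ¬ (e.1 = i ∧ E.w e.1 e.2 ≤ E.w i j)
          space := Function.update s.space i (s.space i + s.free) }

/-- The space `W_i` that `ALG_B` allots to every advertiser. Every effective round removes an
ad, so the algorithm is over after as many rounds as there are reported ads. -/
noncomputable def spaceB (r : Profile N S) : N → ℝ :=
  ((E.stepB r)^[(ads r).card] { free := E.W, avail := ads r, space := fun _ => 0 }).space

/-- `ALG_I`: every advertiser receives the reported ad of highest reported value among those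
that fit in the space allotted by `ALG_B`. -/
noncomputable def algI : AllocRule N S := ofIntegral fun r i =>
  (pick E.tieI (E.adValue r)
    ((ads r).filter fun e => e.1 = i ∧ E.w e.1 e.2 ≤ E.spaceB r i)).map Prod.snd

/-- Only the ad of highest reported value is allocated. -/
noncomputable def algMax : AllocRule N S := ofIntegral fun r i =>
  match pick E.tieM (E.adValue r) (ads r) with
  | none => none
  | some e => if e.1 = i then some e.2 else none

/-- The expected number of clicks of advertiser `i`. -/
def clicks (x : AllocRule N S) (r : Profile N S) (i : N) : ℝ :=
  ∑ j ∈ (r i).2, x r i j * E.α i j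

/-- The GSP cost per click: the infimum of the bids that give `i` the same expected number of
clicks as the actual bid, all other reports being equal. -/
noncomputable def gspPrice (x : AllocRule N S) (r : Profile N S) (i : N) : ℝ≥0 :=
  sInf {b : ℝ≥0 | E.clicks x (Function.update r i (b, (r i).2)) i = E.clicks x r i}

/-- An allocation rule with GSP payments. -/
noncomputable def gsp (x : AllocRule N S) : Mechanism N S where
  alloc := x
  pay r i := E.clicks x r i * (E.gspPrice x r i : ℝ)

/-- `ALG_I` with probability `1/2` and the maximum value ad with probability `1/2`, each with its
own GSP payments. -/
noncomputable def halfMechanism : Mechanism N S := mix (1 / 2) (E.gsp E.algI) (E.gsp E.algMax)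

/-- Quasi-linear utility of advertiser `i` of true type `τ` when the reports are `r`. -/
def utility (M : Mechanism N S) (i : N) (τ : AdType S) (r : Profile N S) : ℝ :=
  (τ.1 : ℝ) * E.clicks M.alloc r i - M.pay r i

/-- Social welfare under the true types `t` of the allocation made for the reports `r`. -/
def welfare (x : AllocRule N S) (t r : Profile N S) : ℝ :=
  ∑ i, ∑ j, x r i j * E.adValue t (i, j)

/-- Optimal social welfare under the true types `t` of an integral allocation: at most one ad for
every advertiser, of total space at most `W`. -/
noncomputable def optWelfare (t : Profile N S) : ℝ :=
  sSup {v : ℝ | ∃ g : N → Option S,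
    (∑ i, (g i).elim 0 (E.w i)) ≤ E.W ∧ v = ∑ i, (g i).elim 0 fun j => E.adValue t (i, j)}

/-- Expected utility of advertiser `i` of true type `τ` who reports `a`: the other advertisers'
types are drawn from the conditional distribution given that `i` has type `τ`, and they report
according to the (randomized) strategies `σ`. -/
noncomputable def interimUtility (M : Mechanism N S) (D : Measure (Profile N S))
    [IsProbabilityMeasure D] (σ : N → Kernel (AdType S) (AdType S)) (i : N) (τ a : AdType S) : ℝ :=
  ∫ t, ∫ r, E.utility M i τ (Function.update r i a) ∂(Measure.pi fun k => σ k (t k))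
    ∂(condDistrib id (fun t : Profile N S => t i) D τ)

/-- The randomized strategies `σ` form a Bayes-Nash equilibrium for the (possibly correlated)
distribution `D` of types: for almost every type `τ` of advertiser `i`, only sets of ads that `i`
has are reported, and no report `(b, A)` with `A ⊆ τ.2` gives more in expectation. -/
def IsBayesNash (M : Mechanism N S) (D : Measure (Profile N S)) [IsProbabilityMeasure D]
    (σ : N → Kernel (AdType S) (AdType S)) : Prop :=
  ∀ i, ∀ᵐ τ ∂(D.map fun t => t i),
    (∀ᵐ a ∂(σ i τ), a.2 ⊆ τ.2) ∧
    ∀ (b : ℝ≥0) (A : Finset S), A ⊆ τ.2 →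
      E.interimUtility M D σ i τ (b, A) ≤ ∫ a, E.interimUtility M D σ i τ a ∂(σ i τ)

/-- No advertiser ever bids more than their value. -/
def NoOverbidding (D : Measure (Profile N S)) (σ : N → Kernel (AdType S) (AdType S)) : Prop :=
  ∀ i, ∀ᵐ τ ∂(D.map fun t => t i), ∀ᵐ a ∂(σ i τ), a.1 ≤ τ.1

/-- Expected optimal welfare. -/
noncomputable def expectedOpt (D : Measure (Profile N S)) : ℝ≥0∞ :=
  ∫⁻ t, ENNReal.ofReal (E.optWelfare t) ∂D

/-- Expected welfare of a mechanism under the strategies `σ`. -/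
noncomputable def expectedWelfare (M : Mechanism N S) (D : Measure (Profile N S))
    (σ : N → Kernel (AdType S) (AdType S)) : ℝ≥0∞ :=
  ∫⁻ t, ∫⁻ r, ENNReal.ofReal (E.welfare M.alloc t r) ∂(Measure.pi fun k => σ k (t k)) ∂D

/-- Bayes-Nash price of anarchy under no overbidding: the supremum of the ratio of expected
optimal welfare to expected welfare over all distributions of types and all Bayes-Nash equilibria
without overbidding. (In `ℝ≥0∞`, `x / 0 = ∞` for `x ≠ 0`, while the meaningless ratios `0 / 0`
and `∞ / ∞` count as `0`.) -/
noncomputable def bayesNashPoA (M : Mechanism N S) : ℝ≥0∞ :=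
  ⨆ (D : Measure (Profile N S)) (_ : IsProbabilityMeasure D)
    (σ : N → Kernel (AdType S) (AdType S)) (_ : ∀ i, IsMarkovKernel (σ i))
    (_ : E.IsBayesNash M D σ) (_ : NoOverbidding D σ),
    E.expectedOpt D / E.expectedWelfare M D σ

end Auction

end RichAds

/-! This is a semi-smoothness argument: a deviation computed from an advertiser's own type alone
does well against every profile of reports, up to a price term that adds up to a multiple of the
declared welfare. Since the deviation ignores the types of the others, correlation is harmless.

Fix the reports and let `spacePrice` be twice the summed declared welfare of the two rules, per unit
of the total space. Whoever bids more than this price for the space of an ad gets at least the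
clicks of that ad under one of the two rules (`clicks_update_ge`). An ad larger than half the space
beats every single competing ad, hence wins `algMax`. If the greedy algorithm denied space to a
smaller ad, the competitors would fill half the space at the density of that ad or more. By
`density_mul_le`, greedy and the best single ad together would then earn more than the price allows.

A bid of `y` times the value therefore has utility at least `(1 - y) / 2` times the value of the ad:
the GSP price is at most the bid, and each rule runs with probability `1/2`. Drawing `y` with
density `1 / (1 - y)` on `(0, 1 - 1/e]` cancels the factor `1 - y` and leaves half of `(1 - 1/e)`
times the value minus the price of the space. Summed over an optimal allocation, whose space is at
most `W`, this bounds `(1 - 1/e) / 2` times the optimum by the deviation utilities plus twice the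
declared welfare (`optWelfare_le`). In equilibrium the former cost at most the welfare once, as
payments are nonnegative; without overbidding the latter costs at most the welfare twice. Hence `3`
in `expectedOpt_le`, and `6` in the end.

The remaining work is measure theory: measurability of the GSP prices, and the passage from interim
to ex-ante expectations. -/

set_option linter.unusedSectionVars false

namespace RichAds

/-! ### Maximizers with tie-breaking -/

section Pick

variable {E : Type*} {prio : E ↪ ℕ} {f g : E → ℝ} {A : Finset E} {e : E}

theorem pick_eq_some_iff :
    pick prio f A = some e ↔ e ∈ A ∧ ∀ e' ∈ A, toLex (f e', prio e') ≤ toLex (f e, prio e) := by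
  unfold pick
  split_ifs with h
  · have hs := (A.exists_max_image (fun e => toLex (f e, prio e)) h).choose_spec
    rw [Option.some_inj]
    constructor
    · rintro rfl
      exact hs
    · rintro ⟨he, hmax⟩
      have h1 := le_antisymm (hs.2 e he) (hmax _ hs.1)
      have h2 := congrArg (fun p => (ofLex p).2) h1
      exact (prio.injective h2).symm
  · simp only [false_iff]
    rintro ⟨he, -⟩
    exact h ⟨e, he⟩

theorem pick_eq_none_iff : pick prio f A = none ↔ A = ∅ := by
  unfold pick
  split_ifs with h
  · simp [h.ne_empty]
  · simpa using h

theorem mem_of_pick (h : pick prio f A = some e) : e ∈ A := (pick_eq_some_iff.1 h).1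

theorem le_of_pick (h : pick prio f A = some e) {e' : E} (he' : e' ∈ A) : f e' ≤ f e := by
  have h1 := (pick_eq_some_iff.1 h).2 e' he'
  rcases Prod.Lex.toLex_le_toLex.1 h1 with h2 | h2
  · exact h2.le
  · exact h2.1.le

theorem exists_pick (h : A.Nonempty) : ∃ e, pick prio f A = some e := by
  rcases hp : pick prio f A with _ | e
  · exact absurd (pick_eq_none_iff.1 hp) h.ne_empty
  · exact ⟨e, rfl⟩

/-- The choice compares values only with each other, so it depends on `f` through its order alone.
This reduces measurability of the mechanism to finitely many comparisons. -/
theorem pick_congr (h : ∀ e e', f e ≤ f e' ↔ g e ≤ g e') : pick prio f A = pick prio g A := by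
  refine Option.ext fun e => ?_
  rw [pick_eq_some_iff, pick_eq_some_iff]
  have key : ∀ e', (toLex (f e', prio e') ≤ toLex (f e, prio e) ↔
      toLex (g e', prio e') ≤ toLex (g e, prio e)) := by
    intro e'
    simp only [Prod.Lex.toLex_le_toLex, lt_iff_le_not_ge, le_antisymm_iff, h]
  simp only [key]

end Pick

/-! ### Invariants of the greedy bang-per-buck algorithm -/

namespace Auction

variable {N S : Type*} [Fintype N] [Fintype S] [DecidableEq N] [DecidableEq S] (E : Auction N S)

theorem adValue_nonneg (r : Profile N S) (e : N × S) : 0 ≤ E.adValue r e := by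
  unfold adValue
  split_ifs
  · exact mul_nonneg (NNReal.coe_nonneg _) (E.α_nonneg _ _)
  · exact le_rfl

theorem adValue_of_mem {r : Profile N S} {e : N × S} (h : e ∈ ads r) :
    E.adValue r e = (r e.1).1 * E.α e.1 e.2 := if_pos (by simpa [ads] using h)

theorem bangPerBuck_mul (r : Profile N S) (e : N × S) :
    E.bangPerBuck r e * E.w e.1 e.2 = E.adValue r e :=
  div_mul_cancel₀ _ (E.w_pos _ _).ne'

theorem bangPerBuck_nonneg (r : Profile N S) (e : N × S) : 0 ≤ E.bangPerBuck r e :=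
  div_nonneg (E.adValue_nonneg r e) (E.w_pos _ _).le

/-- The space conditions that hold throughout `ALG_B`. -/
structure Consistent (r : Profile N S) (s : BState N S) : Prop where
  free_nonneg : 0 ≤ s.free
  sum_space : ∑ k, s.space k = E.W - s.free
  mem_avail : s.free ≠ 0 → ∀ e, e ∈ s.avail ↔ e ∈ ads r ∧ s.space e.1 < E.w e.1 e.2

/-- Unless the space of its owner suffices for the ad `e`, all the space in the state `s` has been
allotted to ads of bang-per-buck at least that of `e`, and at most one of these does not fit. -/
def Dominated (r : Profile N S) (e : N × S) (s : BState N S) : Prop :=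
  E.w e.1 e.2 ≤ s.space e.1 ∨
    ∃ k₀, ∀ k, s.space k = 0 ∨ ∃ l, (k, l) ∈ ads r ∧
      E.bangPerBuck r e ≤ E.bangPerBuck r (k, l) ∧ s.space k ≤ E.w k l ∧
      (s.free ≠ 0 ∨ k ≠ k₀ → s.space k = E.w k l)

variable {E}

theorem stepB_of_free {r : Profile N S} {s : BState N S} (h : s.free = 0) : E.stepB r s = s :=
  if_pos h

theorem stepB_of_empty {r : Profile N S} {s : BState N S} (h : s.avail = ∅) :
    E.stepB r s = s := by
  have : pick E.tieB (E.bangPerBuck r) s.avail = none := pick_eq_none_iff.2 h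
  simp [stepB, this]

/-- The minimum merges the round in which the ad fits with the truncated last round, so each
invariant needs one computation. -/
theorem stepB_of_pick {r : Profile N S} {s : BState N S} (h : s.free ≠ 0) {e : N × S}
    (he : pick E.tieB (E.bangPerBuck r) s.avail = some e) :
    E.stepB r s =
      { free := s.free - min s.free (E.w e.1 e.2 - s.space e.1)
        avail := s.avail.filter fun e' => ¬ (e'.1 = e.1 ∧ E.w e'.1 e'.2 ≤ E.w e.1 e.2)
        space := Function.update s.space e.1
          (s.space e.1 + min s.free (E.w e.1 e.2 - s.space e.1)) } := by
  obtain ⟨i, j⟩ := e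
  simp only [stepB, h, if_false, he]
  split_ifs with hle
  · simp [min_eq_right hle]
  · simp [min_eq_left (not_le.1 hle).le]

theorem Consistent.stepB {r : Profile N S} {s : BState N S} (hs : E.Consistent r s) :
    E.Consistent r (E.stepB r s) := by
  by_cases hf : s.free = 0
  · rwa [stepB_of_free hf]
  rcases hp : pick E.tieB (E.bangPerBuck r) s.avail with _ | e
  · rwa [stepB_of_empty (pick_eq_none_iff.1 hp)]
  rw [stepB_of_pick hf hp]
  have hav := hs.mem_avail hf
  have hlt := ((hav e).1 (mem_of_pick hp)).2
  refine ⟨sub_nonneg.2 (min_le_left _ _), ?_, ?_⟩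
  · simp only
    rw [Finset.sum_update_of_mem (Finset.mem_univ _)]
    have := Finset.add_sum_erase Finset.univ s.space (Finset.mem_univ e.1)
    rw [Finset.sdiff_singleton_eq_erase]
    linarith [hs.sum_space]
  · intro hf' e'
    simp only at hf' ⊢
    -- If the minimum were the free space, none would remain afterwards.
    have hm : min s.free (E.w e.1 e.2 - s.space e.1) = E.w e.1 e.2 - s.space e.1 := by
      rcases min_choice s.free (E.w e.1 e.2 - s.space e.1) with h | h
      · exact absurd (by rw [h, sub_self]) hf'
      · exact h
    rw [hm, Finset.mem_filter, hav]
    by_cases hk : e'.1 = e.1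
    · simp only [hk, true_and, not_le, Function.update_self, add_sub_cancel]
      constructor
      · rintro ⟨⟨h1, h2⟩, h3⟩
        exact ⟨h1, h3⟩
      · rintro ⟨h1, h2⟩
        exact ⟨⟨h1, hlt.trans h2⟩, h2⟩
    · simp [hk]

theorem space_le_stepB {r : Profile N S} {s : BState N S} (hs : E.Consistent r s) (k : N) :
    s.space k ≤ (E.stepB r s).space k := by
  by_cases hf : s.free = 0
  · rw [stepB_of_free hf]
  rcases hp : pick E.tieB (E.bangPerBuck r) s.avail with _ | e
  · rw [stepB_of_empty (pick_eq_none_iff.1 hp)]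
  rw [stepB_of_pick hf hp]
  have hlt := ((hs.mem_avail hf e).1 (mem_of_pick hp)).2
  by_cases hk : k = e.1
  · subst hk
    simpa using ⟨hs.free_nonneg, hlt.le⟩
  · simp [hk]

theorem Dominated.stepB {r : Profile N S} {e : N × S} (he : e ∈ ads r) {s : BState N S}
    (hs : E.Consistent r s) (hd : E.Dominated r e s) : E.Dominated r e (E.stepB r s) := by
  by_cases hf : s.free = 0
  · rwa [stepB_of_free hf]
  rcases hp : pick E.tieB (E.bangPerBuck r) s.avail with _ | m
  · rwa [stepB_of_empty (pick_eq_none_iff.1 hp)]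
  rcases lt_or_ge (s.space e.1) (E.w e.1 e.2) with hw | hw
  swap
  · exact Or.inl (hw.trans (space_le_stepB hs _))
  obtain ⟨k₀, hk₀⟩ := hd.resolve_left (not_le.2 hw)
  have hm := (hs.mem_avail hf m).1 (mem_of_pick hp)
  -- The ad `e` is still available, so the ad picked in this round is at least as dense.
  have hle := le_of_pick hp ((hs.mem_avail hf e).2 ⟨he, hw⟩)
  rw [stepB_of_pick hf hp]
  -- Only the ad picked now can be truncated: space was left before the round, so every earlier
  -- allotment is exact.
  refine Or.inr ⟨m.1, fun k => ?_⟩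
  by_cases hk : k = m.1
  · subst hk
    refine Or.inr ⟨m.2, hm.1, hle, ?_, ?_⟩
    · simp only [Function.update_self]
      linarith [min_le_right s.free (E.w m.1 m.2 - s.space m.1)]
    · intro h
      have hf' := h.resolve_right (fun h => h rfl)
      simp only [Function.update_self] at hf' ⊢
      rcases min_choice s.free (E.w m.1 m.2 - s.space m.1) with h | h
      · exact absurd (by rw [h, sub_self]) hf'
      · rw [h, add_sub_cancel]
  · simp only [Function.update_of_ne hk]
    refine (hk₀ k).imp_right ?_
    rintro ⟨l, h1, h2, h3, h4⟩
    exact ⟨l, h1, h2, h3, fun _ => h4 (Or.inl hf)⟩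

variable (E) in
/-- The state of `ALG_B` after `n` rounds. -/
noncomputable def stateB (r : Profile N S) (n : ℕ) : BState N S :=
  (E.stepB r)^[n] { free := E.W, avail := ads r, space := fun _ => 0 }

theorem stateB_succ (r : Profile N S) (n : ℕ) :
    E.stateB r (n + 1) = E.stepB r (E.stateB r n) := Function.iterate_succ_apply' _ _ _

theorem consistent_stateB (r : Profile N S) (n : ℕ) : E.Consistent r (E.stateB r n) := by
  induction n with
  | zero =>
    refine ⟨E.W_pos.le, ?_, fun _ e => ?_⟩
    · simp [stateB]
    · simp [stateB, E.w_pos]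
  | succ n ih => rw [stateB_succ]; exact ih.stepB

theorem dominated_stateB {r : Profile N S} {e : N × S} (he : e ∈ ads r) (n : ℕ) :
    E.Dominated r e (E.stateB r n) := by
  induction n with
  | zero => exact Or.inr ⟨e.1, fun k => Or.inl rfl⟩
  | succ n ih => rw [stateB_succ]; exact ih.stepB he (consistent_stateB r n)

/-- Each effective round removes at least the picked ad, so `(ads r).card` rounds suffice to use up
the space or the ads. -/
theorem stateB_progress (r : Profile N S) (n : ℕ) :
    (E.stateB r n).free = 0 ∨ (E.stateB r n).avail = ∅ ∨
      (E.stateB r n).avail.card + n ≤ (ads r).card := by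
  induction n with
  | zero => exact Or.inr (Or.inr le_rfl)
  | succ n ih =>
    rw [stateB_succ]
    by_cases hf : (E.stateB r n).free = 0
    · rw [stepB_of_free hf]; exact Or.inl hf
    rcases hp : pick E.tieB (E.bangPerBuck r) (E.stateB r n).avail with _ | m
    · have := pick_eq_none_iff.1 hp
      rw [stepB_of_empty this]; exact Or.inr (Or.inl this)
    have hm := mem_of_pick hp
    have hc := (ih.resolve_left hf).resolve_left (Finset.ne_empty_of_mem hm)
    refine Or.inr (Or.inr ?_)
    rw [stepB_of_pick hf hp]
    have : ((E.stateB r n).avail.filter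
        fun e' => ¬ (e'.1 = m.1 ∧ E.w e'.1 e'.2 ≤ E.w m.1 m.2)).card
        < (E.stateB r n).avail.card :=
      Finset.card_lt_card (Finset.filter_ssubset.2 ⟨m, hm, by simp⟩)
    simp only
    omega

/-- If `ALG_B` does not allot enough space for a reported ad, then the whole space is allotted to
ads of at least the same bang-per-buck, at most one of which does not fit. -/
theorem spaceB_of_lt {r : Profile N S} {e : N × S} (he : e ∈ ads r)
    (hw : E.spaceB r e.1 < E.w e.1 e.2) :
    ∑ k, E.spaceB r k = E.W ∧ ∃ k₀, ∀ k, E.spaceB r k = 0 ∨ ∃ l, (k, l) ∈ ads r ∧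
      E.bangPerBuck r e ≤ E.bangPerBuck r (k, l) ∧ E.spaceB r k ≤ E.w k l ∧
      (k ≠ k₀ → E.spaceB r k = E.w k l) := by
  have hc := consistent_stateB (E := E) r (ads r).card
  have hfree : (E.stateB r (ads r).card).free = 0 := by
    -- With space left, `e` would still be available, yet all rounds have been used.
    by_contra hf
    have hmem := (hc.mem_avail hf e).2 ⟨he, hw⟩
    have hcard := ((stateB_progress r _).resolve_left hf).resolve_left
      (Finset.ne_empty_of_mem hmem)
    have := Finset.card_pos.2 ⟨e, hmem⟩
    omega
  have hsum := hc.sum_space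
  rw [hfree, sub_zero] at hsum
  refine ⟨hsum, ?_⟩
  obtain ⟨k₀, h⟩ := (dominated_stateB (E := E) he (ads r).card).resolve_left (not_le.2 hw)
  refine ⟨k₀, fun k => (h k).imp_right ?_⟩
  rintro ⟨l, h1, h2, h3, h4⟩
  exact ⟨l, h1, h2, h3, fun hk => h4 (Or.inr hk)⟩

end Auction
end RichAds

/-! ### Declared welfare and the price of space -/

namespace RichAds
namespace Auction

variable {N S : Type*} [Fintype N] [Fintype S] [DecidableEq N] [DecidableEq S] {E : Auction N S}

theorem mem_ads {r : Profile N S} {e : N × S} : e ∈ ads r ↔ e.2 ∈ (r e.1).2 := by simp [ads]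

theorem bid_mul_clicks (x : AllocRule N S) (r : Profile N S) (i : N) :
    (r i).1 * E.clicks x r i = ∑ j, x r i j * E.adValue r (i, j) := by
  simp only [clicks, adValue, mul_ite, mul_zero, Finset.mul_sum, Finset.sum_ite_mem,
    Finset.univ_inter]
  exact Finset.sum_congr rfl fun j _ => by ring

theorem welfare_self (x : AllocRule N S) (r : Profile N S) :
    E.welfare x r r = ∑ i, (r i).1 * E.clicks x r i := by
  simp only [welfare, bid_mul_clicks]

/-- The number of clicks under an integral rule that allocates only reported ads. -/
theorem clicks_ofIntegral {g : Profile N S → N → Option S} {r : Profile N S} {i : N} {j : S}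
    (hg : g r i = some j) (hj : j ∈ (r i).2) : E.clicks (ofIntegral g) r i = E.α i j := by
  simp [clicks, ofIntegral, hg, hj]

theorem clicks_ofIntegral_none {g : Profile N S → N → Option S} {r : Profile N S} {i : N}
    (hg : g r i = none) : E.clicks (ofIntegral g) r i = 0 := by
  simp [clicks, ofIntegral, hg]

theorem clicks_ofIntegral_nonneg (g : Profile N S → N → Option S) (r : Profile N S) (i : N) :
    0 ≤ E.clicks (ofIntegral g) r i :=
  Finset.sum_nonneg fun j _ =>
    mul_nonneg (by unfold ofIntegral; split_ifs <;> norm_num) (E.α_nonneg _ _)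

theorem clicks_ofIntegral_le_one (g : Profile N S → N → Option S) (r : Profile N S) (i : N) :
    E.clicks (ofIntegral g) r i ≤ 1 := by
  rcases hg : g r i with _ | j
  · rw [clicks_ofIntegral_none hg]; exact zero_le_one
  · by_cases hj : j ∈ (r i).2
    · rw [clicks_ofIntegral hg hj]; exact E.α_le_one _ _
    · have : E.clicks (ofIntegral g) r i = 0 := by
        refine Finset.sum_eq_zero fun j' hj' => ?_
        have : j ≠ j' := fun h => hj (h ▸ hj')
        simp [ofIntegral, hg, this]
      rw [this]; exact zero_le_one

theorem exists_clicks_algI {r : Profile N S} {e : N × S} (he : e ∈ ads r)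
    (hw : E.w e.1 e.2 ≤ E.spaceB r e.1) :
    ∃ j ∈ (r e.1).2, E.clicks E.algI r e.1 = E.α e.1 j ∧
      E.adValue r e ≤ E.adValue r (e.1, j) := by
  have hmem : e ∈ (ads r).filter fun e' => e'.1 = e.1 ∧ E.w e'.1 e'.2 ≤ E.spaceB r e.1 := by
    simp [he, hw]
  obtain ⟨m, hm⟩ := exists_pick (prio := E.tieI) (f := E.adValue r) ⟨e, hmem⟩
  have hle := le_of_pick hm hmem
  have h2 := Finset.mem_filter.1 (mem_of_pick hm)
  have h3 := mem_ads.1 h2.1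
  obtain ⟨i, j⟩ := m
  obtain rfl : i = e.1 := h2.2.1
  exact ⟨j, h3, clicks_ofIntegral (by simp [hm]) h3, hle⟩

theorem adValue_le_algI {r : Profile N S} {e : N × S} (he : e ∈ ads r)
    (hw : E.w e.1 e.2 ≤ E.spaceB r e.1) :
    E.adValue r e ≤ (r e.1).1 * E.clicks E.algI r e.1 := by
  obtain ⟨j, hj, hc, hle⟩ := exists_clicks_algI he hw
  rw [hc, ← E.adValue_of_mem (e := (e.1, j)) (mem_ads.2 hj)]
  exact hle

theorem exists_clicks_algMax {r : Profile N S} (h : (ads r).Nonempty) :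
    ∃ m ∈ ads r, E.clicks E.algMax r m.1 = E.α m.1 m.2 ∧
      ∀ e ∈ ads r, E.adValue r e ≤ E.adValue r m := by
  obtain ⟨m, hm⟩ := exists_pick (prio := E.tieM) (f := E.adValue r) h
  have hmem := mem_of_pick hm
  exact ⟨m, hmem, clicks_ofIntegral (by simp [hm]) (mem_ads.1 hmem),
    fun e he => le_of_pick hm he⟩

theorem adValue_le_algMax {r : Profile N S} {e : N × S} (he : e ∈ ads r) :
    E.adValue r e ≤ E.welfare E.algMax r r := by
  obtain ⟨m, hm, hc, hle⟩ := exists_clicks_algMax (E := E) ⟨e, he⟩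
  refine (hle e he).trans ?_
  rw [welfare_self, E.adValue_of_mem hm, ← hc]
  exact Finset.single_le_sum (f := fun i => ((r i).1 : ℝ) * E.clicks E.algMax r i)
    (fun i _ => mul_nonneg (NNReal.coe_nonneg _) (clicks_ofIntegral_nonneg _ _ _))
    (Finset.mem_univ m.1)

theorem welfare_algI_nonneg (r : Profile N S) : 0 ≤ E.welfare E.algI r r := by
  rw [welfare_self]
  exact Finset.sum_nonneg fun i _ =>
    mul_nonneg (NNReal.coe_nonneg _) (clicks_ofIntegral_nonneg _ _ _)

theorem welfare_algMax_nonneg (r : Profile N S) : 0 ≤ E.welfare E.algMax r r := by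
  rw [welfare_self]
  exact Finset.sum_nonneg fun i _ =>
    mul_nonneg (NNReal.coe_nonneg _) (clicks_ofIntegral_nonneg _ _ _)

theorem mul_le_adValue {r : Profile N S} {e : N × S} {θ s : ℝ} (hθ : 0 ≤ θ)
    (h : θ ≤ E.bangPerBuck r e) (hs : s ≤ E.w e.1 e.2) : θ * s ≤ E.adValue r e := by
  rw [← bangPerBuck_mul]
  exact (mul_le_mul_of_nonneg_left hs hθ).trans
    (mul_le_mul_of_nonneg_right h (E.w_pos _ _).le)

/-- If half of the space can be filled with ads of bang-per-buck at least `θ`, at most one for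
every advertiser, then the two rules together have declared welfare at least `θ W / 2`. -/
theorem density_mul_le {r : Profile N S} {θ : ℝ} (hθ : 0 ≤ θ) {s : N → ℝ}
    (hs : ∀ k, s k = 0 ∨ ∃ l, (k, l) ∈ ads r ∧ θ ≤ E.bangPerBuck r (k, l) ∧ s k ≤ E.w k l)
    (hsum : E.W / 2 ≤ ∑ k, s k) :
    θ * (E.W / 2) ≤ E.welfare E.algI r r + E.welfare E.algMax r r := by
  have hgain : ∀ k, 0 ≤ (r k).1 * E.clicks E.algI r k := fun k =>
    mul_nonneg (NNReal.coe_nonneg _) (clicks_ofIntegral_nonneg _ _ _)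
  -- If every dense ad fits in the space of its owner, `algI` alone earns enough, since it gives
  -- each owner an ad at least as valuable.
  by_cases hfit : ∀ e ∈ ads r, θ ≤ E.bangPerBuck r e → E.w e.1 e.2 ≤ E.spaceB r e.1
  · calc θ * (E.W / 2) ≤ θ * ∑ k, s k := mul_le_mul_of_nonneg_left hsum hθ
      _ = ∑ k, θ * s k := Finset.mul_sum _ _ _
      _ ≤ ∑ k, (r k).1 * E.clicks E.algI r k := by
        refine Finset.sum_le_sum fun k _ => ?_
        rcases hs k with h | ⟨l, h1, h2, h3⟩
        · rw [h, mul_zero]; exact hgain k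
        · exact (mul_le_adValue (e := (k, l)) hθ h2 h3).trans
            (adValue_le_algI (e := (k, l)) h1 (hfit _ h1 h2))
      _ ≤ _ := by
        rw [← welfare_self]
        linarith [welfare_algMax_nonneg (E := E) r]
  · push Not at hfit
    obtain ⟨e, he, hb, hlt⟩ := hfit
    -- Otherwise greedy has filled all of `W` at density at least `θ`. Every allotment is paid for
    -- by `algI`, except the possibly truncated one of `k₀`, which `algMax` pays for.
    obtain ⟨htot, k₀, hk⟩ := spaceB_of_lt he hlt
    have h1 : ∀ k ∈ Finset.univ.erase k₀,
        θ * E.spaceB r k ≤ (r k).1 * E.clicks E.algI r k := by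
      intro k hkm
      rcases hk k with h | ⟨l, h1, h2, h3, h4⟩
      · rw [h, mul_zero]; exact hgain k
      · exact (mul_le_adValue (e := (k, l)) hθ (hb.trans h2) h3).trans
          (adValue_le_algI (e := (k, l)) h1 (h4 (Finset.ne_of_mem_erase hkm)).ge)
    have h2 : θ * E.spaceB r k₀ ≤ E.welfare E.algMax r r := by
      rcases hk k₀ with h | ⟨l, h1, h2, h3, h4⟩
      · rw [h, mul_zero]; exact welfare_algMax_nonneg r
      · exact (mul_le_adValue (e := (k₀, l)) hθ (hb.trans h2) h3).trans (adValue_le_algMax h1)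
    have h3 := Finset.sum_le_sum h1
    have h4 := Finset.add_sum_erase Finset.univ (fun k => θ * E.spaceB r k) (Finset.mem_univ k₀)
    have h5 := Finset.add_sum_erase Finset.univ (fun k => (r k).1 * E.clicks E.algI r k)
      (Finset.mem_univ k₀)
    rw [← Finset.mul_sum Finset.univ, htot] at h4
    rw [← welfare_self] at h5
    have h6 : θ * (E.W / 2) ≤ θ * E.W := mul_le_mul_of_nonneg_left (by linarith [E.W_pos]) hθ
    linarith [hgain k₀]

/-- The price per unit of space that guarantees winning against the reports `r`. -/
noncomputable def spacePrice (E : Auction N S) (r : Profile N S) : ℝ :=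
  2 * (E.welfare E.algI r r + E.welfare E.algMax r r) / E.W

theorem spacePrice_nonneg (r : Profile N S) : 0 ≤ E.spacePrice r :=
  div_nonneg (mul_nonneg zero_le_two
    (add_nonneg (welfare_algI_nonneg r) (welfare_algMax_nonneg r))) E.W_pos.le

/-- If the allotment were too small, greedy would have filled `W` with ads at least as dense. Less
than half of that belongs to `i`, so the competitors, whose reports are those of `r`, fill at least
half. `density_mul_le` then bounds the density by the price. -/
theorem spaceB_update_ge {r : Profile N S} {i : N} {a : AdType S} {j : S} (hj : j ∈ a.2)
    (hw : E.w i j ≤ E.W / 2) (hb : E.spacePrice r * E.w i j < a.1 * E.α i j) :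
    E.w i j ≤ E.spaceB (Function.update r i a) i := by
  by_contra! hlt
  set r' := Function.update r i a with hr'
  have hmem : (i, j) ∈ ads r' := by simp [mem_ads, hr', hj]
  have hval : E.adValue r' (i, j) = a.1 * E.α i j := by
    rw [E.adValue_of_mem hmem]; simp [hr']
  have hne : ∀ k, k ≠ i → r' k = r k := fun k hk => Function.update_of_ne hk _ _
  obtain ⟨htot, k₀, hk⟩ := spaceB_of_lt hmem hlt
  have hmain := density_mul_le (E := E) (r := r) (θ := E.bangPerBuck r' (i, j))
    (s := fun k => if k = i then 0 else E.spaceB r' k) (E.bangPerBuck_nonneg _ _) ?_ ?_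
  · have hW := E.W_pos
    have h1 : E.bangPerBuck r' (i, j) ≤ E.spacePrice r := by
      rw [spacePrice, le_div_iff₀ hW]; linarith
    have h2 := mul_le_mul_of_nonneg_right h1 (E.w_pos i j).le
    have h3 := E.bangPerBuck_mul r' (i, j)
    simp only at h3
    linarith
  · intro k
    by_cases hki : k = i
    · simp [hki]
    · simp only [hki, if_false]
      refine (hk k).imp_right ?_
      rintro ⟨l, h1, h2, h3, -⟩
      refine ⟨l, ?_, ?_, h3⟩
      · rw [mem_ads] at h1 ⊢
        rwa [← hne k hki]
      · simpa only [bangPerBuck, adValue, hne k hki] using h2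
  · have h1 : (∑ k, if k = i then 0 else E.spaceB r' k)
        = ∑ k ∈ Finset.univ.erase i, E.spaceB r' k := by
      rw [← Finset.add_sum_erase _ _ (Finset.mem_univ i)]
      simp only [if_true, zero_add]
      exact Finset.sum_congr rfl fun k hk => if_neg (Finset.ne_of_mem_erase hk)
    have h2 := Finset.add_sum_erase Finset.univ (E.spaceB r') (Finset.mem_univ i)
    linarith

/-- An advertiser whose bid exceeds the price of the space of one of her ads receives under one of
the two rules at least as many clicks as that ad has. -/
theorem clicks_update_ge {r : Profile N S} {i : N} {a : AdType S} {j : S} (hj : j ∈ a.2)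
    (hb : E.spacePrice r * E.w i j < a.1 * E.α i j) :
    E.α i j ≤ E.clicks E.algI (Function.update r i a) i ∨
      E.α i j ≤ E.clicks E.algMax (Function.update r i a) i := by
  set r' := Function.update r i a with hr'
  have hi : r' i = a := by simp [hr']
  have hmem : (i, j) ∈ ads r' := by simp [mem_ads, hi, hj]
  have hpos : 0 < (a.1 : ℝ) * E.α i j :=
    (mul_nonneg (spacePrice_nonneg r) (E.w_pos i j).le).trans_lt hb
  have ha : 0 < (a.1 : ℝ) := pos_of_mul_pos_left hpos (E.α_nonneg i j)
  have hval : ∀ l ∈ a.2, E.adValue r' (i, l) = a.1 * E.α i l := fun l hl => by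
    rw [E.adValue_of_mem (mem_ads.2 (by simpa [hi] using hl))]; simp [hi]
  rcases le_or_gt (E.w i j) (E.W / 2) with hw | hw
  · left
    obtain ⟨l, hl, hc, hle⟩ := exists_clicks_algI hmem (spaceB_update_ge hj hw hb)
    simp only [hi] at hl hc hle
    rw [hc]
    rw [hval j hj, hval l hl] at hle
    -- All ads of `i` share one positive bid, so a larger reported value means more clicks.
    exact le_of_mul_le_mul_left hle ha
  · right
    obtain ⟨m, hm, hc, hle⟩ := exists_clicks_algMax (E := E) ⟨_, hmem⟩
    have h1 := hle _ hmem
    rw [hval j hj] at h1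
    by_cases hmi : m.1 = i
    · obtain ⟨k, l⟩ := m
      obtain rfl : k = i := hmi
      have hl : l ∈ a.2 := by simpa [mem_ads, hi] using hm
      rw [hval l hl] at h1
      rw [hc]
      exact le_of_mul_le_mul_left h1 ha
    -- A winning ad of a competitor is already present in `r`, so its value is at most the price of
    -- half the space, hence below the bid for the larger ad `j`.
    · exfalso
      have hrm : r' m.1 = r m.1 := Function.update_of_ne hmi _ _
      have hm' : m ∈ ads r := by rw [mem_ads] at hm ⊢; rwa [← hrm]
      have h2 : E.adValue r' m = E.adValue r m := by simp only [adValue, hrm]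
      have h3 := adValue_le_algMax (E := E) hm'
      have h4 : E.welfare E.algMax r r ≤ E.spacePrice r * (E.W / 2) := by
        have : E.spacePrice r * (E.W / 2)
            = E.welfare E.algI r r + E.welfare E.algMax r r := by
          rw [spacePrice]; field_simp [E.W_pos.ne']
        linarith [welfare_algI_nonneg (E := E) r]
      have h5 := mul_le_mul_of_nonneg_left hw.le (spacePrice_nonneg (E := E) r)
      linarith

end Auction
end RichAds

/-! ### Utility bounds from GSP payments -/

namespace RichAds
namespace Auction

variable {N S : Type*} [Fintype N] [Fintype S] [DecidableEq N] [DecidableEq S] {E : Auction N S}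

/-- The actual bid belongs to the set whose infimum is the price. -/
theorem gspPrice_le (x : AllocRule N S) (r : Profile N S) (i : N) :
    E.gspPrice x r i ≤ (r i).1 := by
  refine csInf_le (OrderBot.bddBelow _) ?_
  have : Function.update r i ((r i).1, (r i).2) = r := Function.update_eq_self i r
  simp only [Set.mem_ofPred_eq, this]

theorem clicks_halfMechanism (r : Profile N S) (i : N) :
    E.clicks E.halfMechanism.alloc r i
      = (E.clicks E.algI r i + E.clicks E.algMax r i) / 2 := by
  simp only [clicks, halfMechanism, mix, gsp, ← Finset.sum_add_distrib, Finset.sum_div]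
  exact Finset.sum_congr rfl fun j _ => by ring

theorem welfare_halfMechanism (t r : Profile N S) :
    E.welfare E.halfMechanism.alloc t r
      = (E.welfare E.algI t r + E.welfare E.algMax t r) / 2 := by
  simp only [welfare, halfMechanism, mix, gsp, ← Finset.sum_add_distrib, Finset.sum_div]
  exact Finset.sum_congr rfl fun i _ => Finset.sum_congr rfl fun j _ => by ring

theorem algI_nonneg (r : Profile N S) (i : N) (j : S) : 0 ≤ E.algI r i j := by
  unfold algI ofIntegral; split_ifs <;> norm_num

theorem algMax_nonneg (r : Profile N S) (i : N) (j : S) : 0 ≤ E.algMax r i j := by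
  unfold algMax ofIntegral; split_ifs <;> norm_num

theorem algI_of_notMem {r : Profile N S} {i : N} {j : S} (hj : j ∉ (r i).2) :
    E.algI r i j = 0 := by
  refine if_neg fun h => hj ?_
  obtain ⟨m, hm, rfl⟩ := Option.map_eq_some_iff.1 h
  have h2 := Finset.mem_filter.1 (mem_of_pick hm)
  have h3 := mem_ads.1 h2.1
  rwa [h2.2.1] at h3

theorem algMax_of_notMem {r : Profile N S} {i : N} {j : S} (hj : j ∉ (r i).2) :
    E.algMax r i j = 0 := by
  refine if_neg fun h => hj ?_
  rcases hp : pick E.tieM (E.adValue r) (ads r) with _ | m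
  · simp [hp] at h
  · simp only [hp, Option.ite_none_right_eq_some, Option.some.injEq] at h
    obtain ⟨rfl, rfl⟩ := h
    exact mem_ads.1 (mem_of_pick hp)

theorem halfMechanism_alloc_nonneg (r : Profile N S) (i : N) (j : S) :
    0 ≤ E.halfMechanism.alloc r i j := by
  simp only [halfMechanism, mix, gsp]
  linarith [algI_nonneg (E := E) r i j, algMax_nonneg (E := E) r i j]

theorem halfMechanism_alloc_of_notMem {r : Profile N S} {i : N} {j : S} (hj : j ∉ (r i).2) :
    E.halfMechanism.alloc r i j = 0 := by
  simp [halfMechanism, mix, gsp, algI_of_notMem hj, algMax_of_notMem hj]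

/-- Only ads that an advertiser really has count towards the welfare. -/
theorem value_mul_clicks_halfMechanism {t r : Profile N S} {i : N} (h : (r i).2 ⊆ (t i).2) :
    (t i).1 * E.clicks E.halfMechanism.alloc r i
      = ∑ j, E.halfMechanism.alloc r i j * E.adValue t (i, j) := by
  rw [clicks, Finset.mul_sum, ← Finset.sum_subset (Finset.subset_univ (r i).2)]
  · refine Finset.sum_congr rfl fun j hj => ?_
    rw [E.adValue_of_mem (e := (i, j)) (mem_ads.2 (h hj))]
    ring
  · intro j _ hj
    rw [halfMechanism_alloc_of_notMem hj, zero_mul]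

theorem adValue_mono {t r : Profile N S} {e : N × S} (h1 : (r e.1).1 ≤ (t e.1).1)
    (h2 : (r e.1).2 ⊆ (t e.1).2) : E.adValue r e ≤ E.adValue t e := by
  by_cases he : e ∈ ads r
  · rw [E.adValue_of_mem he, E.adValue_of_mem (mem_ads.2 (h2 (mem_ads.1 he)))]
    exact mul_le_mul_of_nonneg_right (NNReal.coe_le_coe.2 h1) (E.α_nonneg _ _)
  · rw [adValue, if_neg (fun h => he (mem_ads.2 h))]
    exact E.adValue_nonneg t e

theorem welfare_mono {t r : Profile N S} (h1 : ∀ i, (r i).1 ≤ (t i).1)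
    (h2 : ∀ i, (r i).2 ⊆ (t i).2) :
    E.welfare E.halfMechanism.alloc r r ≤ E.welfare E.halfMechanism.alloc t r :=
  Finset.sum_le_sum fun i _ => Finset.sum_le_sum fun j _ =>
    mul_le_mul_of_nonneg_left (adValue_mono (h1 i) (h2 i)) (halfMechanism_alloc_nonneg r i j)

theorem utility_le (i : N) (τ : AdType S) (r : Profile N S) :
    E.utility E.halfMechanism i τ r ≤ τ.1 * E.clicks E.halfMechanism.alloc r i := by
  have hI : 0 ≤ E.clicks E.algI r i := clicks_ofIntegral_nonneg _ _ _
  have hM : 0 ≤ E.clicks E.algMax r i := clicks_ofIntegral_nonneg _ _ _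
  have h1 := mul_nonneg hI (NNReal.coe_nonneg (E.gspPrice E.algI r i))
  have h2 := mul_nonneg hM (NNReal.coe_nonneg (E.gspPrice E.algMax r i))
  have : 0 ≤ E.halfMechanism.pay r i := by
    simp only [halfMechanism, mix, gsp]
    linarith
  simp only [utility]
  linarith

theorem utility_ge (i : N) (τ : AdType S) (r : Profile N S) :
    ((τ.1 : ℝ) - (r i).1) * E.clicks E.halfMechanism.alloc r i
      ≤ E.utility E.halfMechanism i τ r := by
  have hI : 0 ≤ E.clicks E.algI r i := clicks_ofIntegral_nonneg _ _ _
  have hM : 0 ≤ E.clicks E.algMax r i := clicks_ofIntegral_nonneg _ _ _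
  have h1 := mul_le_mul_of_nonneg_left (NNReal.coe_le_coe.2 (gspPrice_le (E := E) E.algI r i)) hI
  have h2 := mul_le_mul_of_nonneg_left
    (NNReal.coe_le_coe.2 (gspPrice_le (E := E) E.algMax r i)) hM
  have : E.halfMechanism.pay r i ≤ (r i).1 * E.clicks E.halfMechanism.alloc r i := by
    rw [clicks_halfMechanism]
    simp only [halfMechanism, mix, gsp]
    linarith
  simp only [utility]
  linarith

theorem clicks_halfMechanism_nonneg (r : Profile N S) (i : N) :
    0 ≤ E.clicks E.halfMechanism.alloc r i := by
  rw [clicks_halfMechanism]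
  have hI : 0 ≤ E.clicks E.algI r i := clicks_ofIntegral_nonneg _ _ _
  have hM : 0 ≤ E.clicks E.algMax r i := clicks_ofIntegral_nonneg _ _ _
  linarith

theorem clicks_halfMechanism_le_one (r : Profile N S) (i : N) :
    E.clicks E.halfMechanism.alloc r i ≤ 1 := by
  rw [clicks_halfMechanism]
  have hI : E.clicks E.algI r i ≤ 1 := clicks_ofIntegral_le_one _ _ _
  have hM : E.clicks E.algMax r i ≤ 1 := clicks_ofIntegral_le_one _ _ _
  linarith

theorem utility_nonneg {i : N} {τ : AdType S} {r : Profile N S} (h : (r i).1 ≤ τ.1) :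
    0 ≤ E.utility E.halfMechanism i τ r :=
  (mul_nonneg (sub_nonneg.2 (NNReal.coe_le_coe.2 h))
    (clicks_halfMechanism_nonneg r i)).trans (utility_ge i τ r)

theorem utility_le_value (i : N) (τ : AdType S) (r : Profile N S) :
    E.utility E.halfMechanism i τ r ≤ τ.1 :=
  (utility_le i τ r).trans
    (mul_le_of_le_one_right (NNReal.coe_nonneg _) (clicks_halfMechanism_le_one r i))

/-- The report of an advertiser of type `τ` who bids the fraction `y` of her value. -/
noncomputable def shade (y : ℝ) (τ : AdType S) : AdType S := (y.toNNReal * τ.1, τ.2)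

theorem shade_fst_le {y : ℝ} (hy : y ≤ 1) (τ : AdType S) : (shade y τ).1 ≤ τ.1 :=
  mul_le_of_le_one_left zero_le (Real.toNNReal_le_one.2 hy)

/-- One of the two rules, run with probability `1/2`, yields the clicks of `j`, and each click
leaves a surplus of at least `1 - y` times the value. The deviation does not depend on `j`, so it
can be compared with whichever ad the optimum assigns. -/
theorem utility_shade_ge {r : Profile N S} {i : N} {τ : AdType S} {j : S} (hj : j ∈ τ.2) {y : ℝ}
    (hy0 : 0 ≤ y) (hy1 : y ≤ 1) (hb : E.spacePrice r * E.w i j < y * (τ.1 * E.α i j)) :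
    (1 - y) * (τ.1 * E.α i j / 2)
      ≤ E.utility E.halfMechanism i τ (Function.update r i (shade y τ)) := by
  refine le_trans ?_ (utility_ge i τ _)
  have hcl : E.α i j / 2
      ≤ E.clicks E.halfMechanism.alloc (Function.update r i (shade y τ)) i := by
    rw [clicks_halfMechanism]
    have hI : 0 ≤ E.clicks E.algI (Function.update r i (shade y τ)) i :=
      clicks_ofIntegral_nonneg _ _ _
    have hM : 0 ≤ E.clicks E.algMax (Function.update r i (shade y τ)) i :=
      clicks_ofIntegral_nonneg _ _ _
    rcases clicks_update_ge (E := E) (r := r) (i := i) (a := shade y τ) (j := j) hj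
      (by simpa [shade, hy0, mul_assoc] using hb) with h | h <;> linarith
  have h0 : 0 ≤ (1 - y) * τ.1 := mul_nonneg (by linarith) (NNReal.coe_nonneg _)
  calc (1 - y) * (τ.1 * E.α i j / 2) = (1 - y) * τ.1 * (E.α i j / 2) := by ring
    _ ≤ (1 - y) * τ.1 * E.clicks E.halfMechanism.alloc (Function.update r i (shade y τ)) i :=
      mul_le_mul_of_nonneg_left hcl h0
    _ = _ := by
      have h1 : ((Function.update r i (shade y τ) i).1 : ℝ) = y * τ.1 := by simp [shade, hy0]
      rw [h1]; ring

end Auction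
end RichAds

/-! ### Measurability of allocations and GSP prices -/

theorem measurable_of_factorsThrough {α β γ : Type*} [MeasurableSpace α] [MeasurableSpace β]
    [MeasurableSpace γ] [Countable γ] [MeasurableSingletonClass γ] {f : α → β} {p : α → γ}
    (hp : Measurable p) (hf : f.FactorsThrough p) : Measurable f := by
  by_cases h : Nonempty β
  · obtain ⟨b⟩ := h
    rw [← hf.extend_comp (fun _ => b)]
    exact Measurable.of_discrete.comp hp
  · have : IsEmpty α := ⟨fun a => h ⟨f a⟩⟩
    exact measurable_of_empty f

namespace RichAds
namespace Auction

variable {N S : Type*} [Fintype N] [Fintype S] [DecidableEq N] [DecidableEq S] {E : Auction N S}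

theorem measurable_adValue (e : N × S) : Measurable fun r : Profile N S => E.adValue r e := by
  unfold adValue
  refine Measurable.ite ?_ (by fun_prop) measurable_const
  have : Measurable fun r : Profile N S => (r e.1).2 := by fun_prop
  exact this (measurableSet_mem_finset e.2)

theorem measurable_bangPerBuck (e : N × S) :
    Measurable fun r : Profile N S => E.bangPerBuck r e :=
  (measurable_adValue e).div_const _

theorem measurable_ads : Measurable fun r : Profile N S => ads r := by
  rw [measurable_finset_iff]
  intro e
  simp only [mem_ads]
  have : Measurable fun r : Profile N S => (r e.1).2 := by fun_prop
  exact (measurable_finset_mem e.2).comp this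

/-- The comparisons on which the allocation depends. -/
def pattern (E : Auction N S) (r : Profile N S) :
    (N × S → N × S → Prop) × (N × S → N × S → Prop) × Finset (N × S) :=
  (fun e e' => E.bangPerBuck r e ≤ E.bangPerBuck r e',
    fun e e' => E.adValue r e ≤ E.adValue r e', ads r)

theorem measurable_pattern : Measurable E.pattern := by
  refine Measurable.prodMk ?_ (Measurable.prodMk ?_ measurable_ads)
  · refine measurable_pi_lambda _ fun e => measurable_pi_lambda _ fun e' => ?_
    exact measurableSet_setOfPred.1
      (measurableSet_le (measurable_bangPerBuck e) (measurable_bangPerBuck e'))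
  · refine measurable_pi_lambda _ fun e => measurable_pi_lambda _ fun e' => ?_
    exact measurableSet_setOfPred.1 (measurableSet_le (measurable_adValue e) (measurable_adValue e'))

theorem pattern_eq_iff {r r' : Profile N S} : E.pattern r = E.pattern r' ↔
    (∀ e e', E.bangPerBuck r e ≤ E.bangPerBuck r e' ↔ E.bangPerBuck r' e ≤ E.bangPerBuck r' e') ∧
    (∀ e e', E.adValue r e ≤ E.adValue r e' ↔ E.adValue r' e ≤ E.adValue r' e') ∧
    ads r = ads r' := by
  simp only [pattern, Prod.mk.injEq, funext_iff, eq_iff_iff]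

theorem spaceB_congr {r r' : Profile N S} (h : E.pattern r = E.pattern r') :
    E.spaceB r = E.spaceB r' := by
  obtain ⟨h1, -, h3⟩ := pattern_eq_iff.1 h
  have hstep : E.stepB r = E.stepB r' := by
    funext s
    simp only [stepB, pick_congr h1]
  simp only [spaceB, hstep, h3]

theorem algI_congr {r r' : Profile N S} (h : E.pattern r = E.pattern r') :
    E.algI r = E.algI r' := by
  obtain ⟨-, h2, h3⟩ := pattern_eq_iff.1 h
  funext i j
  simp only [algI, ofIntegral, pick_congr h2, h3, spaceB_congr h]

theorem algMax_congr {r r' : Profile N S} (h : E.pattern r = E.pattern r') :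
    E.algMax r = E.algMax r' := by
  obtain ⟨-, h2, h3⟩ := pattern_eq_iff.1 h
  funext i j
  simp only [algMax, ofIntegral, pick_congr h2, h3]

/-- An allocation rule that depends only on comparisons of values and bang-per-bucks. -/
def Ordinal (E : Auction N S) (x : AllocRule N S) : Prop :=
  ∀ r r', E.pattern r = E.pattern r' → x r = x r'

variable {x : AllocRule N S}

theorem Ordinal.clicks_congr (hx : E.Ordinal x) {r r' : Profile N S}
    (h : E.pattern r = E.pattern r') (i : N) : E.clicks x r i = E.clicks x r' i := by
  have h2 : (r i).2 = (r' i).2 := by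
    ext j
    have := (pattern_eq_iff.1 h).2.2
    rw [← mem_ads (e := (i, j)), this, mem_ads]
  simp only [clicks, hx _ _ h, h2]

theorem Ordinal.measurable_alloc (hx : E.Ordinal x) (i : N) (j : S) :
    Measurable fun r => x r i j :=
  measurable_of_factorsThrough measurable_pattern fun r r' h => by rw [hx r r' h]

theorem Ordinal.measurable_clicks (hx : E.Ordinal x) (i : N) :
    Measurable fun r => E.clicks x r i :=
  measurable_of_factorsThrough measurable_pattern fun _ _ h => hx.clicks_congr h i

/-- The profile `r` with the bid of `i` replaced by `b`. -/
abbrev withBid (r : Profile N S) (i : N) (b : ℝ≥0) : Profile N S :=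
  Function.update r i (b, (r i).2)

theorem measurable_withBid (i : N) :
    Measurable fun p : Profile N S × ℝ≥0 => withBid p.1 i p.2 := by
  refine measurable_pi_lambda _ fun k => ?_
  by_cases hk : k = i
  · subst hk
    simp only [withBid, Function.update_self]
    fun_prop
  · simp only [withBid, Function.update_of_ne hk]
    fun_prop

theorem measurable_withBid_const (i : N) (b : ℝ≥0) :
    Measurable fun r : Profile N S => withBid r i b :=
  (measurable_withBid i).comp (measurable_id.prodMk measurable_const)

theorem ads_withBid (r : Profile N S) (i : N) (b : ℝ≥0) : ads (withBid r i b) = ads r := by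
  ext e
  rw [mem_ads, mem_ads]
  by_cases hk : e.1 = i
  · rw [hk]; simp [withBid]
  · simp [withBid, hk]

/-- Values are affine in the bid of `i`, so two ads with different slopes tie at no more than one
bid. -/
theorem adValue_withBid (r : Profile N S) (i : N) (b : ℝ≥0) (e : N × S) :
    E.adValue (withBid r i b) e = E.adValue (withBid r i 0) e
      + b * (E.adValue (withBid r i 1) e - E.adValue (withBid r i 0) e) := by
  by_cases hk : e.1 = i
  · simp [adValue, withBid, hk]
  · simp [adValue, withBid, hk]

theorem bangPerBuck_withBid (r : Profile N S) (i : N) (b : ℝ≥0) (e : N × S) :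
    E.bangPerBuck (withBid r i b) e = E.bangPerBuck (withBid r i 0) e
      + b * (E.bangPerBuck (withBid r i 1) e - E.bangPerBuck (withBid r i 0) e) := by
  simp only [bangPerBuck]
  rw [adValue_withBid]
  ring

/-- The bid of `i` at which the ads `e` and `e'` tie with respect to `f`. -/
noncomputable def crossing (f : Profile N S → N × S → ℝ) (i : N) (e e' : N × S)
    (r : Profile N S) : ℝ≥0 :=
  ((f (withBid r i 0) e' - f (withBid r i 0) e) /
    ((f (withBid r i 1) e - f (withBid r i 0) e)
      - (f (withBid r i 1) e' - f (withBid r i 0) e'))).toNNReal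

theorem measurable_crossing {f : Profile N S → N × S → ℝ} (hf : ∀ e, Measurable fun r => f r e)
    (i : N) (e e' : N × S) : Measurable (crossing f i e e') := by
  have h : ∀ b e, Measurable fun r => f (withBid r i b) e := fun b e =>
    (hf e).comp (measurable_withBid_const i b)
  exact ((((h _ _).sub (h _ _)).div (((h _ _).sub (h _ _)).sub ((h _ _).sub (h _ _))))).real_toNNReal

/-- A strict comparison persists by continuity. A tie away from the crossing bid forces equal
slopes, hence a tie at every bid. -/
theorem eventually_le_iff {f : Profile N S → N × S → ℝ} {i : N} {r : Profile N S}
    (hf : ∀ b e, f (withBid r i b) e = f (withBid r i 0) e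
      + b * (f (withBid r i 1) e - f (withBid r i 0) e)) {b : ℝ≥0} {e e' : N × S}
    (hb : b ≠ crossing f i e e' r) :
    ∀ᶠ q in nhds b, (f (withBid r i q) e ≤ f (withBid r i q) e'
      ↔ f (withBid r i b) e ≤ f (withBid r i b) e') := by
  have hcont : ∀ e, Continuous fun q : ℝ≥0 => f (withBid r i q) e := by
    intro e
    rw [funext fun q => hf q e]
    fun_prop
  rcases lt_trichotomy (f (withBid r i b) e) (f (withBid r i b) e') with h | h | h
  · filter_upwards [(hcont e).continuousAt.eventually_lt (hcont e').continuousAt h] with q hq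
    exact iff_of_true hq.le h.le
  · have key : (f (withBid r i 1) e - f (withBid r i 0) e)
        - (f (withBid r i 1) e' - f (withBid r i 0) e') = 0 := by
      by_contra hne
      refine hb ?_
      rw [hf b e, hf b e'] at h
      rw [crossing, (div_eq_iff hne).2 (_ : _ = (b : ℝ) * _), Real.toNNReal_coe]
      linarith
    refine Filter.Eventually.of_forall fun q => ?_
    have : f (withBid r i q) e = f (withBid r i q) e' := by
      rw [hf b e, hf b e'] at h
      rw [hf q e, hf q e']
      have h2 := sub_eq_zero.1 key
      rw [h2] at h ⊢
      linarith
    exact iff_of_true this.le h.le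
  · filter_upwards [(hcont e').continuousAt.eventually_lt (hcont e).continuousAt h] with q hq
    exact iff_of_false hq.not_ge h.not_ge

/-- The bids at which the comparisons may change, together with the rational bids. -/
noncomputable def testBid (E : Auction N S) (i : N) :
    ℚ ⊕ (N × S) × (N × S) ⊕ (N × S) × (N × S) → Profile N S → ℝ≥0
  | Sum.inl q, _ => (q : ℝ).toNNReal
  | Sum.inr (Sum.inl p), r => crossing E.bangPerBuck i p.1 p.2 r
  | Sum.inr (Sum.inr p), r => crossing E.adValue i p.1 p.2 r

theorem measurable_testBid (i : N) (m) : Measurable (E.testBid i m) := by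
  rcases m with q | p | p
  · exact measurable_const
  · exact measurable_crossing measurable_bangPerBuck _ _ _
  · exact measurable_crossing measurable_adValue _ _ _

theorem eventually_pattern_eq {i : N} {r : Profile N S} {b : ℝ≥0}
    (hb : ∀ m, b ≠ E.testBid i m r) :
    ∀ᶠ q in nhds b, E.pattern (withBid r i q) = E.pattern (withBid r i b) := by
  simp only [pattern_eq_iff, ads_withBid, and_true, Filter.eventually_and, Filter.eventually_all]
  exact ⟨fun e e' => eventually_le_iff (bangPerBuck_withBid r i) (hb (Sum.inr (Sum.inl (e, e')))),
    fun e e' => eventually_le_iff (adValue_withBid r i) (hb (Sum.inr (Sum.inr (e, e'))))⟩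

/-- The infimum runs over uncountably many bids. At a bid that is not a test bid the allocation is
locally constant, so a nearby rational bid serves as well, and countably many test bids decide the
inequality. -/
theorem Ordinal.gspPrice_lt_iff (hx : E.Ordinal x) {i : N} {r : Profile N S} {c : ℝ≥0} :
    E.gspPrice x r i < c ↔ ∃ m, E.testBid i m r < c ∧
      E.clicks x (withBid r i (E.testBid i m r)) i = E.clicks x r i := by
  have hne : {b : ℝ≥0 | E.clicks x (withBid r i b) i = E.clicks x r i}.Nonempty := by
    refine ⟨(r i).1, ?_⟩
    have : withBid r i (r i).1 = r := Function.update_eq_self i r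
    simp only [Set.mem_ofPred_eq, this]
  unfold gspPrice
  rw [csInf_lt_iff (OrderBot.bddBelow _) hne]
  constructor
  · rintro ⟨b, hb, hbc⟩
    by_cases h : ∃ m, b = E.testBid i m r
    · obtain ⟨m, rfl⟩ := h
      exact ⟨m, hbc, hb⟩
    push Not at h
    have hev := (eventually_pattern_eq h).and (gt_mem_nhds hbc)
    obtain ⟨d, hd, hd'⟩ : ∃ d > b, Set.Ico b d ⊆ {q | E.pattern (withBid r i q)
        = E.pattern (withBid r i b) ∧ q < c} := exists_Ico_subset_of_mem_nhds hev ⟨c, hbc⟩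
    obtain ⟨q, hq1, hq2⟩ := exists_rat_btwn (NNReal.coe_lt_coe.2 hd)
    have hq0 : (0 : ℝ) ≤ q := (NNReal.coe_nonneg b).trans hq1.le
    have hq := hd' ⟨(NNReal.le_toNNReal_of_coe_le hq1.le),
      (Real.toNNReal_lt_iff_lt_coe hq0).2 hq2⟩
    exact ⟨Sum.inl q, hq.2, (hx.clicks_congr hq.1 i).trans hb⟩
  · rintro ⟨m, h1, h2⟩
    exact ⟨_, h2, h1⟩

theorem Ordinal.measurable_gspPrice (hx : E.Ordinal x) (i : N) :
    Measurable fun r => E.gspPrice x r i := by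
  refine measurable_of_Iio fun c => ?_
  have : (fun r => E.gspPrice x r i) ⁻¹' Set.Iio c = ⋃ m, ({r | E.testBid i m r < c} ∩
      {r | E.clicks x (withBid r i (E.testBid i m r)) i = E.clicks x r i}) := by
    ext r
    simp [hx.gspPrice_lt_iff]
  rw [this]
  refine MeasurableSet.iUnion fun m => MeasurableSet.inter ?_ ?_
  · exact measurableSet_lt (measurable_testBid i m) measurable_const
  · exact measurableSet_eq_fun ((hx.measurable_clicks i).comp
      ((measurable_withBid i).comp (measurable_id.prodMk (measurable_testBid i m))))
      (hx.measurable_clicks i)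

theorem ordinal_algI : E.Ordinal E.algI := fun _ _ => algI_congr

theorem ordinal_algMax : E.Ordinal E.algMax := fun _ _ => algMax_congr

theorem measurable_halfMechanism_alloc (i : N) (j : S) :
    Measurable fun r => E.halfMechanism.alloc r i j :=
  ((ordinal_algI.measurable_alloc i j).const_mul _).add
    ((ordinal_algMax.measurable_alloc i j).const_mul _)

theorem measurable_halfMechanism_pay (i : N) : Measurable fun r => E.halfMechanism.pay r i :=
  (((ordinal_algI.measurable_clicks i).mul
    (ordinal_algI.measurable_gspPrice i).coe_nnreal_real).const_mul _).add
    (((ordinal_algMax.measurable_clicks i).mul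
    (ordinal_algMax.measurable_gspPrice i).coe_nnreal_real).const_mul _)

theorem measurable_halfMechanism_clicks (i : N) :
    Measurable fun r => E.clicks E.halfMechanism.alloc r i := by
  simp only [clicks_halfMechanism]
  exact ((ordinal_algI.measurable_clicks i).add (ordinal_algMax.measurable_clicks i)).div_const _

theorem measurable_utility (i : N) : Measurable fun p : AdType S × Profile N S =>
    E.utility E.halfMechanism i p.1 p.2 := by
  unfold utility
  exact ((by fun_prop : Measurable fun p : AdType S × Profile N S => ((p.1.1 : ℝ≥0) : ℝ)).mul
    ((measurable_halfMechanism_clicks i).comp measurable_snd)).sub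
    ((measurable_halfMechanism_pay i).comp measurable_snd)

theorem measurable_welfare : Measurable fun p : Profile N S × Profile N S =>
    E.welfare E.halfMechanism.alloc p.1 p.2 := by
  unfold welfare
  exact Finset.measurable_sum _ fun i _ => Finset.measurable_sum _ fun j _ =>
    ((measurable_halfMechanism_alloc i j).comp measurable_snd).mul
      ((measurable_adValue _).comp measurable_fst)

theorem measurable_update (i : N) : Measurable fun p : Profile N S × AdType S =>
    Function.update p.1 i p.2 := by
  refine measurable_pi_lambda _ fun k => ?_
  by_cases hk : k = i
  · subst hk
    simp only [Function.update_self]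
    fun_prop
  · simp only [Function.update_of_ne hk]
    fun_prop

theorem measurable_shade : Measurable fun p : ℝ × AdType S => shade p.1 p.2 := by
  unfold shade
  fun_prop

end Auction
end RichAds

/-! ### Random shading and semi-smoothness -/

namespace RichAds

/-- The constant `1 - 1/e`. -/
noncomputable def shadeBound : ℝ := 1 - 1 / Real.exp 1

theorem shadeBound_pos : 0 < shadeBound := by
  have h : 1 < Real.exp 1 := Real.one_lt_exp_iff.2 one_pos
  rw [shadeBound, sub_pos, div_lt_one (by positivity)]
  exact h

theorem shadeBound_lt_one : shadeBound < 1 := by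
  have : 0 < 1 / Real.exp 1 := by positivity
  rw [shadeBound]; linarith

/-- The distribution on `(0, 1 - 1/e]` with density `1 / (1 - y)`. -/
noncomputable def shadeLaw : Measure ℝ :=
  (volume.restrict (Set.Ioc 0 shadeBound)).withDensity fun y => ENNReal.ofReal (1 / (1 - y))

theorem measurable_shadeDensity :
    Measurable fun y : ℝ => ENNReal.ofReal (1 / (1 - y)) := by
  fun_prop

theorem lintegral_shadeLaw {g : ℝ → ℝ≥0∞} (hg : Measurable g) :
    ∫⁻ y, g y ∂shadeLaw
      = ∫⁻ y in Set.Ioc 0 shadeBound, ENNReal.ofReal (1 / (1 - y)) * g y := by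
  rw [shadeLaw, lintegral_withDensity_eq_lintegral_mul _ measurable_shadeDensity hg]
  rfl

theorem ae_shadeLaw : ∀ᵐ y ∂shadeLaw, y ≤ 1 := by
  refine (withDensity_absolutelyContinuous _ _).ae_le ?_
  filter_upwards [ae_restrict_mem measurableSet_Ioc] with y hy
  exact hy.2.trans shadeBound_lt_one.le

instance : IsProbabilityMeasure shadeLaw := by
  refine ⟨?_⟩
  have h1 : shadeLaw Set.univ = ∫⁻ y in Set.Ioc 0 shadeBound, ENNReal.ofReal (1 / (1 - y)) := by
    rw [shadeLaw, withDensity_apply _ MeasurableSet.univ, Measure.restrict_univ]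
  have hpos : ∀ y ∈ Set.uIcc 0 shadeBound, 1 - y ≠ 0 := by
    intro y hy
    rw [Set.uIcc_of_le shadeBound_pos.le] at hy
    linarith [hy.2, shadeBound_lt_one]
  have hint : IntervalIntegrable (fun y : ℝ => 1 / (1 - y)) volume 0 shadeBound := by
    refine ContinuousOn.intervalIntegrable ?_
    exact ContinuousOn.div continuousOn_const (by fun_prop) hpos
  -- The integral is `log (1 / (1 - shadeBound))`, and `1 - shadeBound = 1/e`: this fixes the
  -- constant.
  have h2 : ∫ y in (0 : ℝ)..shadeBound, 1 / (1 - y) = 1 := by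
    have := intervalIntegral.integral_comp_sub_left (fun x : ℝ => 1 / x) (1 : ℝ)
      (a := 0) (b := shadeBound)
    rw [this, integral_one_div]
    · simp [shadeBound]
    · have : 0 < 1 - shadeBound := by linarith [shadeBound_lt_one]
      rw [Set.uIcc_of_le (by linarith [shadeBound_pos])]
      exact fun h => this.not_ge h.1
  rw [h1, ← ofReal_integral_eq_lintegral_ofReal, ← intervalIntegral.integral_of_le
    shadeBound_pos.le, h2, ENNReal.ofReal_one]
  · exact (intervalIntegrable_iff_integrableOn_Ioc_of_le shadeBound_pos.le).1 hint
  · filter_upwards [ae_restrict_mem measurableSet_Ioc] with y hy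
    have : y < 1 := hy.2.trans_lt shadeBound_lt_one
    exact div_nonneg zero_le_one (by linarith)

namespace Auction

variable {N S : Type*} [Fintype N] [Fintype S] [DecidableEq N] [DecidableEq S] {E : Auction N S}

theorem measurable_utility_shade (i : N) :
    Measurable fun p : ℝ × Profile N S × Profile N S => E.utility E.halfMechanism i (p.2.1 i)
      (Function.update p.2.2 i (shade p.1 (p.2.1 i))) := by
  refine (measurable_utility i).comp (Measurable.prodMk (by fun_prop) ?_)
  refine (measurable_update i).comp (Measurable.prodMk (by fun_prop) ?_)
  exact measurable_shade.comp (f := fun p : ℝ × Profile N S × Profile N S => (p.1, p.2.1 i))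
    (by fun_prop)

/-- Averaging over the shading factor turns the price of an ad into a linear loss. -/
theorem lintegral_utility_shade_ge (t r : Profile N S) (i : N) (j : S) :
    ENNReal.ofReal ((shadeBound * E.adValue t (i, j) - E.spacePrice r * E.w i j) / 2)
      ≤ ∫⁻ y, ENNReal.ofReal (E.utility E.halfMechanism i (t i)
          (Function.update r i (shade y (t i)))) ∂shadeLaw := by
  have hp : 0 ≤ E.spacePrice r * E.w i j := mul_nonneg (spacePrice_nonneg r) (E.w_pos i j).le
  set p := E.spacePrice r * E.w i j with hpdef
  set v := E.adValue t (i, j) with hvdef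
  rcases le_or_gt (shadeBound * v) p with hle | hlt
  · rw [ENNReal.ofReal_of_nonpos (by linarith)]
    exact zero_le
  have hv : 0 < v := pos_of_mul_pos_right (hp.trans_lt hlt) shadeBound_pos.le
  have hj : j ∈ (t i).2 := by
    by_contra hj
    rw [hvdef, adValue, if_neg hj] at hv
    exact hv.false
  have hval : v = (t i).1 * E.α i j := E.adValue_of_mem (e := (i, j)) (mem_ads.2 hj)
  have hmeas : Measurable fun y => ENNReal.ofReal (E.utility E.halfMechanism i (t i)
      (Function.update r i (shade y (t i)))) :=
    ((measurable_utility_shade i).comp (f := fun y : ℝ => (y, t, r)) (by fun_prop)).ennreal_ofReal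
  rw [lintegral_shadeLaw hmeas]
  -- A shading factor above `p / v` outbids the price. On `(p / v, shadeBound]` the density cancels
  -- `1 - y`, leaving the constant `v / 2`.
  have hp0 : 0 ≤ p / v := div_nonneg hp hv.le
  calc ENNReal.ofReal ((shadeBound * v - p) / 2)
      = ∫⁻ _ in Set.Ioc (p / v) shadeBound, ENNReal.ofReal (v / 2) := by
        rw [setLIntegral_const, Real.volume_Ioc, ← ENNReal.ofReal_mul (by linarith)]
        congr 1
        field_simp
    _ ≤ ∫⁻ y in Set.Ioc (p / v) shadeBound, ENNReal.ofReal (1 / (1 - y)) *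
          ENNReal.ofReal (E.utility E.halfMechanism i (t i)
            (Function.update r i (shade y (t i)))) := by
        refine setLIntegral_mono (measurable_shadeDensity.mul hmeas) fun y hy => ?_
        have hy1 : 0 < 1 - y := by linarith [hy.2, shadeBound_lt_one]
        rw [← ENNReal.ofReal_mul (by positivity)]
        refine ENNReal.ofReal_le_ofReal ?_
        rw [one_div, inv_mul_eq_div, le_div_iff₀ hy1, mul_comm, hval]
        refine utility_shade_ge hj (hp0.trans hy.1.le) (by linarith) ?_
        rw [← hval, ← hpdef]
        exact (div_lt_iff₀ hv).1 hy.1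
    _ ≤ _ := lintegral_mono_set (Set.Ioc_subset_Ioc_left hp0)

theorem exists_optWelfare_eq (t : Profile N S) : ∃ g : N → Option S,
    (∑ i, (g i).elim 0 (E.w i)) ≤ E.W ∧
      E.optWelfare t = ∑ i, (g i).elim 0 fun j => E.adValue t (i, j) := by
  have hfin : {v : ℝ | ∃ g : N → Option S, (∑ i, (g i).elim 0 (E.w i)) ≤ E.W ∧
      v = ∑ i, (g i).elim 0 fun j => E.adValue t (i, j)}.Finite := by
    refine (Set.finite_range fun g : N → Option S =>
      ∑ i, (g i).elim 0 fun j => E.adValue t (i, j)).subset ?_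
    rintro v ⟨g, -, rfl⟩
    exact ⟨g, rfl⟩
  refine Set.Nonempty.csSup_mem ?_ hfin
  exact ⟨_, fun _ => none, by simpa using E.W_pos.le, rfl⟩

/-- The semi-smoothness inequality. -/
theorem optWelfare_le (t r : Profile N S) :
    ENNReal.ofReal (shadeBound / 2 * E.optWelfare t) ≤
      (∑ i, ∫⁻ y, ENNReal.ofReal (E.utility E.halfMechanism i (t i)
          (Function.update r i (shade y (t i)))) ∂shadeLaw)
        + ENNReal.ofReal (2 * E.welfare E.halfMechanism.alloc r r) := by
  obtain ⟨g, hg, hopt⟩ := exists_optWelfare_eq (E := E) t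
  set f : N → ℝ := fun i => (g i).elim 0 fun j =>
    (shadeBound * E.adValue t (i, j) - E.spacePrice r * E.w i j) / 2 with hf
  have hsum : ∑ i, f i = shadeBound / 2 * E.optWelfare t
      - E.spacePrice r / 2 * ∑ i, (g i).elim 0 (E.w i) := by
    rw [hopt, Finset.mul_sum, Finset.mul_sum, ← Finset.sum_sub_distrib]
    refine Finset.sum_congr rfl fun i _ => ?_
    simp only [hf]
    rcases g i with _ | j
    · simp
    · simp only [Option.elim_some]; ring
  have hprice : E.spacePrice r / 2 * E.W = 2 * E.welfare E.halfMechanism.alloc r r := by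
    rw [welfare_halfMechanism, spacePrice]
    field_simp [E.W_pos.ne']
  have hle : shadeBound / 2 * E.optWelfare t
      ≤ ∑ i, f i + 2 * E.welfare E.halfMechanism.alloc r r := by
    have := mul_le_mul_of_nonneg_left hg 
      (div_nonneg (spacePrice_nonneg (E := E) r) zero_le_two)
    linarith
  refine (ENNReal.ofReal_le_ofReal hle).trans (ENNReal.ofReal_add_le.trans ?_)
  refine add_le_add_left ?_ _
  -- Some terms may be negative, but the sum is at most the sum of the positive parts.
  refine (Finset.le_sum_of_subadditive ENNReal.ofReal ENNReal.ofReal_zero.le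
    (fun _ _ => ENNReal.ofReal_add_le) _ _).trans (Finset.sum_le_sum fun i _ => ?_)
  simp only [hf]
  rcases g i with _ | j
  · simp
  · exact lintegral_utility_shade_ge t r i j

end Auction
end RichAds

/-! ### Joint law of types and reports -/

/-- No integrability is needed, because the default value of the integral is `0`. Equilibrium
utilities can thus be bounded above unconditionally. -/
theorem MeasureTheory.ofReal_integral_le_lintegral_ofReal {α : Type*} [MeasurableSpace α]
    {μ : Measure α} (f : α → ℝ) :
    ENNReal.ofReal (∫ a, f a ∂μ) ≤ ∫⁻ a, ENNReal.ofReal (f a) ∂μ := by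
  by_cases hf : Integrable f μ
  · rw [integral_eq_lintegral_pos_part_sub_lintegral_neg_part hf]
    refine (ENNReal.ofReal_le_ofReal (sub_le_self _ ENNReal.toReal_nonneg)).trans ?_
    exact ENNReal.ofReal_toReal_le
  · rw [integral_undef hf, ENNReal.ofReal_zero]
    exact zero_le

/-- Resampling one coordinate of a product of probability measures does not change its law. -/
theorem MeasureTheory.Measure.lintegral_pi_update {ι : Type*} [Fintype ι] [DecidableEq ι]
    {X : ι → Type*} [∀ i, MeasurableSpace (X i)] (μ : ∀ i, Measure (X i))
    [∀ i, IsProbabilityMeasure (μ i)] (i : ι) {f : (∀ i, X i) → ℝ≥0∞} (hf : Measurable f) :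
    ∫⁻ a, ∫⁻ x, f (Function.update x i a) ∂Measure.pi μ ∂μ i = ∫⁻ x, f x ∂Measure.pi μ := by
  have hm : Measurable fun p : X i × (∀ i, X i) => Function.update p.2 i p.1 := by
    refine measurable_pi_lambda _ fun k => ?_
    by_cases hk : k = i
    · subst hk
      simp only [Function.update_self]
      fun_prop
    · simp only [Function.update_of_ne hk]
      fun_prop
  have hpi : Measure.pi μ = ((μ i).prod (Measure.pi μ)).map
      fun p : X i × (∀ i, X i) => Function.update p.2 i p.1 := by
    -- The preimage of a box is a product in which coordinate `i` of the old profile is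
    -- unconstrained and contributes the factor `1`.
    refine Measure.pi_eq fun s hs => ?_
    rw [Measure.map_apply hm (MeasurableSet.univ_pi hs)]
    have : (fun p : X i × (∀ i, X i) => Function.update p.2 i p.1) ⁻¹' Set.pi Set.univ s
        = s i ×ˢ Set.pi Set.univ (Function.update s i Set.univ) := by
      ext p
      simp only [Set.mem_preimage, Set.mem_pi, Set.mem_univ, true_implies, Set.mem_prod]
      constructor
      · intro h
        refine ⟨by simpa using h i, fun k => ?_⟩
        by_cases hk : k = i
        · subst hk; simp
        · simpa [hk] using h k
      · rintro ⟨h1, h2⟩ k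
        by_cases hk : k = i
        · subst hk; simpa using h1
        · simpa [hk] using h2 k
    rw [this, Measure.prod_prod, Measure.pi_pi,
      ← Finset.mul_prod_erase Finset.univ (fun k => μ k (s k)) (Finset.mem_univ i),
      ← Finset.mul_prod_erase Finset.univ (fun k => μ k (Function.update s i Set.univ k))
        (Finset.mem_univ i)]
    simp only [Function.update_self, measure_univ, one_mul]
    congr 1
    refine Finset.prod_congr rfl fun k hk => ?_
    rw [Function.update_of_ne (Finset.ne_of_mem_erase hk)]
  conv_rhs => rw [hpi]
  rw [lintegral_map hf hm]
  exact (lintegral_prod _ (hf.comp hm).aemeasurable).symm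

namespace RichAds

variable {N S : Type*} [Fintype N] [Fintype S]

/-- The joint law of the reports given the types. -/
noncomputable def reportKernel (σ : N → Kernel (AdType S) (AdType S))
    [∀ i, IsMarkovKernel (σ i)] : Kernel (Profile N S) (Profile N S) where
  toFun t := Measure.pi fun k => σ k (t k)
  measurable' := by
    refine Measurable.measure_of_isPiSystem_of_isProbabilityMeasure
      generateFrom_pi.symm isPiSystem_pi ?_
    rintro _ ⟨s, hs, rfl⟩
    simp only [Measure.pi_pi]
    exact Finset.measurable_prod _ fun k _ =>
      ((σ k).measurable_coe (hs k (Set.mem_univ k))).comp (measurable_pi_apply k)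

theorem reportKernel_apply (σ : N → Kernel (AdType S) (AdType S)) [∀ i, IsMarkovKernel (σ i)]
    (t : Profile N S) : reportKernel σ t = Measure.pi fun k => σ k (t k) := rfl

instance (σ : N → Kernel (AdType S) (AdType S)) [∀ i, IsMarkovKernel (σ i)] :
    IsMarkovKernel (reportKernel σ) :=
  ⟨fun t => by rw [reportKernel_apply]; infer_instance⟩

theorem ae_reportKernel {D : Measure (Profile N S)} {σ : N → Kernel (AdType S) (AdType S)}
    [∀ i, IsMarkovKernel (σ i)] {P : N → AdType S → AdType S → Prop}
    (h : ∀ i, ∀ᵐ τ ∂(D.map fun t => t i), ∀ᵐ a ∂(σ i τ), P i τ a) :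
    ∀ᵐ t ∂D, ∀ᵐ r ∂(reportKernel σ t), ∀ i, P i (t i) (r i) := by
  have h1 : ∀ i, ∀ᵐ t ∂D, ∀ᵐ a ∂(σ i (t i)), P i (t i) a := fun i =>
    ae_of_ae_map (measurable_pi_apply i).aemeasurable (h i)
  filter_upwards [ae_all_iff.2 h1] with t ht
  rw [ae_all_iff]
  intro i
  rw [reportKernel_apply]
  exact Measure.tendsto_eval_ae_ae.eventually (ht i)

theorem lintegral_condDistrib_eval {D : Measure (Profile N S)} [IsProbabilityMeasure D] (i : N)
    {f : AdType S × Profile N S → ℝ≥0∞} (hf : Measurable f) :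
    ∫⁻ τ, ∫⁻ t, f (τ, t) ∂(condDistrib id (fun t : Profile N S => t i) D τ)
      ∂(D.map fun t => t i) = ∫⁻ t, f (t i, t) ∂D := by
  rw [← Measure.lintegral_compProd hf, compProd_map_condDistrib aemeasurable_id,
    lintegral_map hf (by fun_prop)]
  rfl

variable [DecidableEq N] [DecidableEq S] {D : Measure (Profile N S)} [IsProbabilityMeasure D]
  {σ : N → Kernel (AdType S) (AdType S)} [∀ i, IsMarkovKernel (σ i)]

/-- Integrating the conditional law over the type of `i` recovers the prior. Given the types,
reports are independent, so redrawing the report of `i` from her own strategy changes nothing. -/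
theorem lintegral_report (i : N) {f : AdType S × Profile N S → ℝ≥0∞} (hf : Measurable f) :
    ∫⁻ τ, ∫⁻ a, ∫⁻ t, ∫⁻ r, f (τ, Function.update r i a) ∂(reportKernel σ t)
        ∂(condDistrib id (fun t : Profile N S => t i) D τ) ∂(σ i τ) ∂(D.map fun t => t i)
      = ∫⁻ t, ∫⁻ r, f (t i, r) ∂(reportKernel σ t) ∂D := by
  have hm : Measurable fun p : (AdType S × AdType S × Profile N S) × Profile N S =>
      f (p.1.1, Function.update p.2 i p.1.2.1) :=
    hf.comp (Measurable.prodMk (by fun_prop) ((Auction.measurable_update i).comp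
      (f := fun p : (AdType S × AdType S × Profile N S) × Profile N S => (p.2, p.1.2.1))
      (by fun_prop)))
  have hm2 : Measurable fun q : AdType S × AdType S × Profile N S =>
      ∫⁻ r, f (q.1, Function.update r i q.2.1) ∂(reportKernel σ q.2.2) :=
    Measurable.lintegral_kernel_prod_right (κ := (reportKernel σ).comap
      (fun q : AdType S × AdType S × Profile N S => q.2.2) (by fun_prop)) hm
  have hm3 : Measurable fun q : AdType S × Profile N S =>
      ∫⁻ a, ∫⁻ r, f (q.1, Function.update r i a) ∂(reportKernel σ q.2) ∂(σ i q.1) :=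
    Measurable.lintegral_kernel_prod_right (κ := (σ i).comap
      (fun q : AdType S × Profile N S => q.1) (by fun_prop))
      (hm2.comp (f := fun q : (AdType S × Profile N S) × AdType S => (q.1.1, q.2, q.1.2))
        (by fun_prop))
  calc _ = ∫⁻ τ, ∫⁻ t, ∫⁻ a, ∫⁻ r, f (τ, Function.update r i a) ∂(reportKernel σ t) ∂(σ i τ)
        ∂(condDistrib id (fun t : Profile N S => t i) D τ) ∂(D.map fun t => t i) := by
        refine lintegral_congr fun τ => lintegral_lintegral_swap ?_
        exact (hm2.comp (f := fun q : AdType S × Profile N S => (τ, q.1, q.2))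
          (by fun_prop)).aemeasurable
    _ = ∫⁻ t, ∫⁻ a, ∫⁻ r, f (t i, Function.update r i a) ∂(reportKernel σ t) ∂(σ i (t i)) ∂D :=
        lintegral_condDistrib_eval i hm3
    _ = _ := by
        refine lintegral_congr fun t => ?_
        exact Measure.lintegral_pi_update (fun k => σ k (t k)) i
          (hf.comp (f := fun r => (t i, r)) (by fun_prop))

/-! ### Equilibrium inequalities in expectation -/

namespace Auction

variable {E : Auction N S}

/-- For a report that does not overbid, the interim utility is a genuine expectation. -/
theorem ofReal_interimUtility (i : N) {τ a : AdType S} (ha : a.1 ≤ τ.1) :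
    ENNReal.ofReal (E.interimUtility E.halfMechanism D σ i τ a)
      = ∫⁻ t, ∫⁻ r, ENNReal.ofReal (E.utility E.halfMechanism i τ (Function.update r i a))
        ∂(reportKernel σ t) ∂(condDistrib id (fun t : Profile N S => t i) D τ) := by
  have hm : Measurable fun r : Profile N S =>
      E.utility E.halfMechanism i τ (Function.update r i a) :=
    (measurable_utility i).comp (Measurable.prodMk measurable_const
      ((measurable_update i).comp (Measurable.prodMk measurable_id measurable_const)))
  have h0 : ∀ r : Profile N S, 0 ≤ E.utility E.halfMechanism i τ (Function.update r i a) :=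
    fun r => utility_nonneg (by simpa using ha)
  have hle : ∀ r : Profile N S, E.utility E.halfMechanism i τ (Function.update r i a) ≤ τ.1 :=
    fun r => utility_le_value _ _ _
  have hint : ∀ t, Integrable (fun r : Profile N S =>
      E.utility E.halfMechanism i τ (Function.update r i a)) (reportKernel σ t) := fun t =>
    Integrable.of_bound hm.aestronglyMeasurable τ.1
      (Filter.Eventually.of_forall fun r => by
        rw [Real.norm_of_nonneg (h0 r)]; exact hle r)
  have hm2 : Measurable fun t => ∫ r, E.utility E.halfMechanism i τ (Function.update r i a)
      ∂(reportKernel σ t) := hm.stronglyMeasurable.integral_kernel.measurable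
  have h02 : ∀ t, 0 ≤ ∫ r, E.utility E.halfMechanism i τ (Function.update r i a)
      ∂(reportKernel σ t) := fun t => integral_nonneg h0
  have hle2 : ∀ t, ∫ r, E.utility E.halfMechanism i τ (Function.update r i a)
      ∂(reportKernel σ t) ≤ τ.1 := fun t => by
    simpa using integral_mono (hint t) (integrable_const (τ.1 : ℝ)) hle
  change ENNReal.ofReal (∫ t, ∫ r, E.utility E.halfMechanism i τ (Function.update r i a)
    ∂(reportKernel σ t) ∂_) = _
  rw [ofReal_integral_eq_lintegral_ofReal _ (Filter.Eventually.of_forall h02)]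
  · refine lintegral_congr fun t => ?_
    exact ofReal_integral_eq_lintegral_ofReal (hint t) (Filter.Eventually.of_forall h0)
  · exact Integrable.of_bound hm2.aestronglyMeasurable τ.1
      (Filter.Eventually.of_forall fun t => by
        rw [Real.norm_of_nonneg (h02 t)]; exact hle2 t)

theorem ofReal_integral_interimUtility_le (i : N) (τ : AdType S) :
    ENNReal.ofReal (∫ a, E.interimUtility E.halfMechanism D σ i τ a ∂(σ i τ))
      ≤ ∫⁻ a, ∫⁻ t, ∫⁻ r, ENNReal.ofReal (τ.1 *
          E.clicks E.halfMechanism.alloc (Function.update r i a) i) ∂(reportKernel σ t)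
          ∂(condDistrib id (fun t : Profile N S => t i) D τ) ∂(σ i τ) := by
  refine (ofReal_integral_le_lintegral_ofReal _).trans (lintegral_mono fun a => ?_)
  refine (ofReal_integral_le_lintegral_ofReal _).trans (lintegral_mono fun t => ?_)
  refine (ofReal_integral_le_lintegral_ofReal _).trans (lintegral_mono fun r => ?_)
  exact ENNReal.ofReal_le_ofReal (utility_le _ _ _)

/-- For a fixed factor `y` the shaded report is a legitimate pure deviation without overbidding, so
its interim utility is a true expectation, at most the equilibrium utility. Dropping payments bounds
the latter by value times clicks. -/
theorem lintegral_utility_shade_le (h : E.IsBayesNash E.halfMechanism D σ) (i : N) {y : ℝ}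
    (hy : y ≤ 1) :
    ∫⁻ t, ∫⁻ r, ENNReal.ofReal (E.utility E.halfMechanism i (t i)
        (Function.update r i (shade y (t i)))) ∂(reportKernel σ t) ∂D
      ≤ ∫⁻ t, ∫⁻ r, ENNReal.ofReal ((t i).1 * E.clicks E.halfMechanism.alloc r i)
        ∂(reportKernel σ t) ∂D := by
  have hm1 : Measurable fun p : AdType S × Profile N S =>
      ENNReal.ofReal (p.1.1 * E.clicks E.halfMechanism.alloc p.2 i) :=
    ((by fun_prop : Measurable fun p : AdType S × Profile N S => ((p.1.1 : ℝ≥0) : ℝ)).mul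
      ((measurable_halfMechanism_clicks i).comp measurable_snd)).ennreal_ofReal
  have hm2 : Measurable fun p : (AdType S × Profile N S) × Profile N S =>
      ENNReal.ofReal (E.utility E.halfMechanism i p.1.1
        (Function.update p.2 i (shade y p.1.1))) := by
    have h1 : Measurable fun p : (AdType S × Profile N S) × Profile N S => shade y p.1.1 :=
      measurable_shade.comp (f := fun p : (AdType S × Profile N S) × Profile N S =>
        (y, p.1.1)) (by fun_prop)
    have h2 : Measurable fun p : (AdType S × Profile N S) × Profile N S =>
        Function.update p.2 i (shade y p.1.1) := (measurable_update i).comp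
      (f := fun p : (AdType S × Profile N S) × Profile N S => (p.2, shade y p.1.1))
      (measurable_snd.prodMk h1)
    exact ((measurable_utility i).comp (f := fun p : (AdType S × Profile N S) × Profile N S =>
      (p.1.1, Function.update p.2 i (shade y p.1.1)))
      ((by fun_prop : Measurable fun p : (AdType S × Profile N S) × Profile N S => p.1.1).prodMk
        h2)).ennreal_ofReal
  have hm3 : Measurable fun p : AdType S × Profile N S =>
      ∫⁻ r, ENNReal.ofReal (E.utility E.halfMechanism i p.1
        (Function.update r i (shade y p.1))) ∂(reportKernel σ p.2) :=
    Measurable.lintegral_kernel_prod_right (κ := (reportKernel σ).comap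
      (fun q : AdType S × Profile N S => q.2) (by fun_prop)) hm2
  rw [← lintegral_report i hm1, ← lintegral_condDistrib_eval i hm3]
  refine lintegral_mono_ae ?_
  filter_upwards [h i] with τ hτ
  rw [← ofReal_interimUtility i (shade_fst_le hy τ)]
  exact (ENNReal.ofReal_le_ofReal (hτ.2 _ _ (Finset.Subset.refl _))).trans
    (ofReal_integral_interimUtility_le i τ)

theorem expectedWelfare_eq (E : Auction N S) (D : Measure (Profile N S))
    (σ : N → Kernel (AdType S) (AdType S)) [∀ i, IsMarkovKernel (σ i)] :
    E.expectedWelfare E.halfMechanism D σ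
      = ∫⁻ t, ∫⁻ r, ENNReal.ofReal (E.welfare E.halfMechanism.alloc t r)
        ∂(reportKernel σ t) ∂D := rfl

theorem sum_lintegral_clicks_le (h : E.IsBayesNash E.halfMechanism D σ) :
    ∑ i, ∫⁻ t, ∫⁻ r, ENNReal.ofReal ((t i).1 * E.clicks E.halfMechanism.alloc r i)
        ∂(reportKernel σ t) ∂D ≤ E.expectedWelfare E.halfMechanism D σ := by
  have hm : ∀ i, Measurable fun p : Profile N S × Profile N S =>
      ENNReal.ofReal ((p.1 i).1 * E.clicks E.halfMechanism.alloc p.2 i) := fun i =>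
    ((by fun_prop : Measurable fun p : Profile N S × Profile N S => (((p.1 i).1 : ℝ≥0) : ℝ)).mul
      ((measurable_halfMechanism_clicks i).comp measurable_snd)).ennreal_ofReal
  rw [← lintegral_finsetSum _ fun i _ => Measurable.lintegral_kernel_prod_right (hm i),
    expectedWelfare_eq]
  refine lintegral_mono_ae ?_
  filter_upwards [ae_reportKernel (P := fun _ τ a => a.2 ⊆ τ.2)
    fun i => (h i).mono fun _ hτ => hτ.1] with t ht
  have hmt : ∀ i, Measurable fun r : Profile N S =>
      ENNReal.ofReal ((t i).1 * E.clicks E.halfMechanism.alloc r i) := fun i =>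
    (hm i).comp measurable_prodMk_left
  rw [← lintegral_finsetSum _ fun i _ => hmt i]
  refine lintegral_mono_ae ?_
  filter_upwards [ht] with r hr
  rw [← ENNReal.ofReal_sum_of_nonneg fun i _ =>
    mul_nonneg (NNReal.coe_nonneg _) (clicks_halfMechanism_nonneg r i)]
  refine ENNReal.ofReal_le_ofReal (le_of_eq ?_)
  rw [welfare]
  exact Finset.sum_congr rfl fun i _ => value_mul_clicks_halfMechanism (hr i)

/-- Almost surely bids are at most values and the reported ads are real, so declared values are at
most true values, ad by ad. -/
theorem lintegral_declaredWelfare_le (h : E.IsBayesNash E.halfMechanism D σ)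
    (hb : NoOverbidding D σ) :
    ∫⁻ t, ∫⁻ r, ENNReal.ofReal (E.welfare E.halfMechanism.alloc r r) ∂(reportKernel σ t) ∂D
      ≤ E.expectedWelfare E.halfMechanism D σ := by
  rw [expectedWelfare_eq]
  refine lintegral_mono_ae ?_
  filter_upwards [ae_reportKernel (P := fun _ τ a => a.2 ⊆ τ.2)
    fun i => (h i).mono fun _ hτ => hτ.1, ae_reportKernel (P := fun _ τ a => a.1 ≤ τ.1) hb]
    with t ht ht'
  refine lintegral_mono_ae ?_
  filter_upwards [ht, ht'] with r hr hr'
  exact ENNReal.ofReal_le_ofReal (welfare_mono hr' hr)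

theorem expectedOpt_le (h : E.IsBayesNash E.halfMechanism D σ) (hb : NoOverbidding D σ) :
    ENNReal.ofReal (shadeBound / 2) * E.expectedOpt D
      ≤ 3 * E.expectedWelfare E.halfMechanism D σ := by
  set J := D ⊗ₘ reportKernel σ with hJ
  have hu : ∀ i, Measurable fun p : ℝ × Profile N S × Profile N S =>
      ENNReal.ofReal (E.utility E.halfMechanism i (p.2.1 i)
        (Function.update p.2.2 i (shade p.1 (p.2.1 i)))) :=
    fun i => (measurable_utility_shade i).ennreal_ofReal
  have hu' : ∀ i, Measurable fun p : Profile N S × Profile N S =>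
      ∫⁻ y, ENNReal.ofReal (E.utility E.halfMechanism i (p.1 i)
        (Function.update p.2 i (shade y (p.1 i)))) ∂shadeLaw :=
    fun i => (hu i).lintegral_prod_left'
  have hw : Measurable fun p : Profile N S × Profile N S =>
      ENNReal.ofReal (2 * E.welfare E.halfMechanism.alloc p.2 p.2) :=
    ((measurable_welfare.comp (measurable_snd.prodMk measurable_snd)).const_mul 2).ennreal_ofReal
  have hpos := shadeBound_pos
  calc ENNReal.ofReal (shadeBound / 2) * E.expectedOpt D
      = ∫⁻ t, ∫⁻ _, ENNReal.ofReal (shadeBound / 2 * E.optWelfare t) ∂(reportKernel σ t) ∂D := by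
        simp only [lintegral_const, measure_univ, mul_one,
          ENNReal.ofReal_mul (by positivity : 0 ≤ shadeBound / 2)]
        rw [lintegral_const_mul' _ _ ENNReal.ofReal_ne_top]
        rfl
    _ ≤ ∫⁻ t, ∫⁻ r, ((∑ i, ∫⁻ y, ENNReal.ofReal (E.utility E.halfMechanism i (t i)
          (Function.update r i (shade y (t i)))) ∂shadeLaw)
        + ENNReal.ofReal (2 * E.welfare E.halfMechanism.alloc r r)) ∂(reportKernel σ t) ∂D :=
        lintegral_mono fun t => lintegral_mono fun r => optWelfare_le t r
    _ = ∫⁻ p, ((∑ i, ∫⁻ y, ENNReal.ofReal (E.utility E.halfMechanism i (p.1 i)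
          (Function.update p.2 i (shade y (p.1 i)))) ∂shadeLaw)
        + ENNReal.ofReal (2 * E.welfare E.halfMechanism.alloc p.2 p.2)) ∂J :=
        (Measure.lintegral_compProd
          ((Finset.measurable_sum _ fun i _ => hu' i).add hw)).symm
    _ = (∑ i, ∫⁻ y, ∫⁻ p, ENNReal.ofReal (E.utility E.halfMechanism i (p.1 i)
          (Function.update p.2 i (shade y (p.1 i)))) ∂J ∂shadeLaw)
        + ∫⁻ p, ENNReal.ofReal (2 * E.welfare E.halfMechanism.alloc p.2 p.2) ∂J := by
        rw [lintegral_add_right _ hw, lintegral_finsetSum _ fun i _ => hu' i]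
        congr 1
        refine Finset.sum_congr rfl fun i _ => ?_
        -- Averaging over `y` moves outside, so that the equilibrium condition is applied to one
        -- pure deviation at a time.
        exact (lintegral_lintegral_swap (f := fun (y : ℝ) (p : Profile N S × Profile N S) =>
          ENNReal.ofReal (E.utility E.halfMechanism i (p.1 i)
            (Function.update p.2 i (shade y (p.1 i))))) (hu i).aemeasurable).symm
    -- The deviation utilities cost the welfare once, the price of the whole space twice.
    _ ≤ E.expectedWelfare E.halfMechanism D σ
        + 2 * E.expectedWelfare E.halfMechanism D σ := by
        refine add_le_add ?_ ?_
        · refine le_trans (Finset.sum_le_sum fun i _ => ?_) (sum_lintegral_clicks_le h)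
          refine (lintegral_mono_ae (g := fun _ => ∫⁻ t, ∫⁻ r, ENNReal.ofReal ((t i).1 *
            E.clicks E.halfMechanism.alloc r i) ∂(reportKernel σ t) ∂D) ?_).trans (by simp)
          filter_upwards [ae_shadeLaw] with y hy
          have huy : Measurable fun p : Profile N S × Profile N S =>
              ENNReal.ofReal (E.utility E.halfMechanism i (p.1 i)
                (Function.update p.2 i (shade y (p.1 i)))) := (hu i).comp measurable_prodMk_left
          rw [hJ, Measure.lintegral_compProd huy]
          exact lintegral_utility_shade_le h i hy
        · rw [hJ, Measure.lintegral_compProd hw]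
          simp only [ENNReal.ofReal_mul zero_le_two, ENNReal.ofReal_ofNat]
          simp only [lintegral_const_mul' _ _ ENNReal.ofNat_ne_top]
          exact mul_le_mul_right (lintegral_declaredWelfare_le h hb) _
    _ = 3 * E.expectedWelfare E.halfMechanism D σ := by ring

end Auction
end RichAds

theorem mainTheorem6 {N S : Type*} [Fintype N] [Fintype S] [DecidableEq N] [DecidableEq S]
    (E : RichAds.Auction N S) :
    E.bayesNashPoA E.halfMechanism ≤ ENNReal.ofReal (6 / (1 - 1 / Real.exp 1)) := by
  refine iSup_le fun D => iSup_le fun _ => iSup_le fun σ => iSup_le fun _ => iSup_le fun h =>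
    iSup_le fun hb => ENNReal.div_le_of_le_mul ?_
  have hpos := RichAds.shadeBound_pos
  have hle := RichAds.Auction.expectedOpt_le h hb
  have hc : ENNReal.ofReal (6 / RichAds.shadeBound)
      = ENNReal.ofReal (2 / RichAds.shadeBound) * 3 := by
    rw [← ENNReal.ofReal_ofNat 3, ← ENNReal.ofReal_mul (by positivity)]
    congr 1
    ring
  have h1 : ENNReal.ofReal (2 / RichAds.shadeBound) * ENNReal.ofReal (RichAds.shadeBound / 2)
      = 1 := by
    rw [← ENNReal.ofReal_mul (by positivity), ← ENNReal.ofReal_one]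
    congr 1
    field_simp
  change _ ≤ ENNReal.ofReal (6 / RichAds.shadeBound) * _
  rw [hc, mul_assoc]
  calc E.expectedOpt D = ENNReal.ofReal (2 / RichAds.shadeBound) *
      (ENNReal.ofReal (RichAds.shadeBound / 2) * E.expectedOpt D) := by
        rw [← mul_assoc, h1, one_mul]
    _ ≤ _ := mul_le_mul_right hle _
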